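/- Let $[z]$ be an entire function of $z\in\mathbb{C}$, not identically zero, such that $$[z+\alpha][z-\alpha][\beta+\gamma][\beta-\gamma]+[z+\beta][z-\beta][\gamma+\alpha][\gamma-\alpha]+[z+\gamma][z-\gamma][\alpha+\beta][\alpha-\beta]=0$$ for all $z,\alpha,\beta,\gamma\in\mathbb{C}$. Let $n$ be a natural number and let $\delta,\kappa\in\mathbb{C}$ be such that $[k\delta]\neq 0$ for every integer $k\ge 1$. For $x=(x_1,\ldots,x_n)$ let $T_{x_i}^{c}$ denote the shift $x_i\mapsto x_i+c$ in the variable $x_i$. Consider the following $\mathbb{C}$-linear operators on the field of meromorphic functions on $\mathbb{C}^n$. For $r=0,1,2,\ldots$ let $$D_r=\sum_{I\subseteq\{1,\ldots,n\},\ |I|=r}\ \prod_{i\in I,\ j\notin I}\frac{[x_i-x_j+\kappa]}{[x_i-x_j]}\ \prod_{i\in I}T_{x_i}^{\delta}$$ (so $D_0=1$ and $D_r=0$ for $r>n$), and for $l=0,1,2,\ldots$ let $$H_l=\sum_{\mu\in\mathbb{N}^n,\ \mu_1+\cdots+\mu_n=l}\ \prod_{1\le i<j\le n}\frac{[x_i-x_j+(\mu_i-\mu_j)\delta]}{[x_i-x_j]}\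 \prod_{i,j=1}^{n}\ \prod_{k=0}^{\mu_i-1}\frac{[x_i-x_j+\kappa+k\delta]}{[x_i-x_j+\delta+k\delta]}\ \prod_{i=1}^{n}T_{x_i}^{\mu_i\delta}.$$ Then the operators $D_r$ commute with each other, so that the $\mathbb{C}$-algebra $\mathbb{C}[D_1,\ldots,D_n]$ generated by $D_1,\ldots,D_n$ is commutative, and every $H_l$ $(l=0,1,2,\ldots)$ belongs to $\mathbb{C}[D_1,\ldots,D_n]$. In particular, $$D_rH_s=H_sD_r,\qquad H_rH_s=H_sH_r\qquad(r,s=0,1,2,\ldots).$$ -/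

import Mathlib

namespace Ruijsenaars

noncomputable section

/-- The ring of entire functions on `ℂⁿ`. -/
def Entire (n : ℕ) : Subalgebra ℂ ((Fin n → ℂ) → ℂ) where
  carrier := {f | AnalyticOnNhd ℂ f Set.univ}
  mul_mem' hf hg := fun x hx => (hf x hx).mul (hg x hx)
  add_mem' hf hg := fun x hx => (hf x hx).add (hg x hx)
  algebraMap_mem' _ := fun _ _ => analyticAt_const

/-- By the identity theorem, the ring of entire functions on `ℂⁿ` is an integral domain. -/
instance instIsDomainEntire (n : ℕ) : IsDomain (Entire n) := by
  have : NoZeroDivisors (Entire n) := by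
    refine ⟨?_⟩
    rintro ⟨f, hf⟩ ⟨g, hg⟩ hfg
    have hfg' : ∀ x, f x * g x = 0 := fun x => congrFun (congrArg Subtype.val hfg) x
    by_cases h : f = 0
    · exact Or.inl (Subtype.ext h)
    · right
      obtain ⟨x, hx⟩ := Function.ne_iff.mp h
      have hev : ∀ᶠ y in nhds x, f y ≠ 0 := (hf x trivial).continuousAt.eventually_ne hx
      have hz : g =ᶠ[nhds x] 0 := by
        filter_upwards [hev] with y hy
        exact (mul_eq_zero.mp (hfg' y)).resolve_left hy
      exact Subtype.ext
        (AnalyticOnNhd.eq_of_eventuallyEq hg (fun _ _ => analyticAt_const) hz)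
  have : Nontrivial (Entire n) :=
    ⟨⟨0, 1, fun h => zero_ne_one (congrFun (congrArg Subtype.val h) 0)⟩⟩
  exact NoZeroDivisors.to_isDomain _

/-- The field of meromorphic functions on `ℂⁿ`, as the field of quotients `f / g` of entire
functions with `g` not identically zero (on `ℂⁿ` every meromorphic function is of this form). -/
abbrev Mero (n : ℕ) : Type := FractionRing (Entire n)

/-- Translation `f(x) ↦ f(x + c)` of entire functions. -/
def entireShift {n : ℕ} (c : Fin n → ℂ) : Entire n ≃ₐ[ℂ] Entire n where
  toFun f := ⟨fun x => f.1 (x + c), fun x _ =>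
    AnalyticAt.comp (g := f.1) (f := fun y => y + c) (f.2 (x + c) trivial) (by fun_prop)⟩
  invFun f := ⟨fun x => f.1 (x - c), fun x _ =>
    AnalyticAt.comp (g := f.1) (f := fun y => y - c) (f.2 (x - c) trivial) (by fun_prop)⟩
  left_inv f := Subtype.ext (funext fun x => by simp)
  right_inv f := Subtype.ext (funext fun x => by simp)
  map_mul' _ _ := rfl
  map_add' _ _ := rfl
  commutes' _ := rfl

/-- Translation `f(x) ↦ f(x + c)` of meromorphic functions, as the automorphism of the field of
meromorphic functions that extends the translation of entire functions. -/
def meroShift {n : ℕ} (c : Fin n → ℂ) : Mero n ≃ₐ[ℂ] Mero n :=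
  IsLocalization.algEquivOfAlgEquiv (M := nonZeroDivisors (Entire n))
    (T := nonZeroDivisors (Entire n)) (Mero n) (Mero n) (entireShift c)
    (MulEquivClass.map_nonZeroDivisors (entireShift c))

/-- The `ℂ`-linear operators on meromorphic functions, with composition as multiplication. -/
abbrev Op (n : ℕ) : Type := Module.End ℂ (Mero n)

/-- The shift operator `x ↦ x + c`, acting by `(T f)(x) = f(x + c)`. For `c = μδ` this is
`T_{x₁}^{μ₁δ} ⋯ T_{xₙ}^{μₙδ}`. -/
def T {n : ℕ} (c : Fin n → ℂ) : Op n := (meroShift c).toLinearMap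

/-- The operator of multiplication by a meromorphic function. -/
def mulOp {n : ℕ} (a : Mero n) : Op n := LinearMap.mulLeft ℂ a

/-- The meromorphic (in fact entire) function `x ↦ [x_i - x_j + c]` on `ℂⁿ`, for an entire
function `[z] = φ z`. -/
def brk {φ : ℂ → ℂ} (hφ : Differentiable ℂ φ) {n : ℕ} (i j : Fin n) (c : ℂ) : Mero n :=
  algebraMap (Entire n) (Mero n) ⟨fun x => φ (x i - x j + c), fun x _ =>
    AnalyticAt.comp (g := φ) (f := fun y : Fin n → ℂ => y i - y j + c)
      (hφ.analyticAt _)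
      ((((ContinuousLinearMap.proj (R := ℂ) (φ := fun _ : Fin n => ℂ) i).analyticAt x).sub
        ((ContinuousLinearMap.proj (R := ℂ) (φ := fun _ : Fin n => ℂ) j).analyticAt x)).add
        analyticAt_const)⟩

/-- The Ruijsenaars operator
`D_r = ∑_{|I| = r} ∏_{i ∈ I, j ∉ I} [x_i - x_j + κ] / [x_i - x_j] ∏_{i ∈ I} T_{x_i}^δ`.
By this formula `D_0 = 1`, and `D_r = 0` for `r > n`. -/
def D {φ : ℂ → ℂ} (hφ : Differentiable ℂ φ) (δ κ : ℂ) (n r : ℕ) : Op n :=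
  ∑ I ∈ Finset.powersetCard r (Finset.univ : Finset (Fin n)),
    mulOp (∏ i ∈ I, ∏ j ∈ Iᶜ, brk hφ i j κ / brk hφ i j 0) *
      T (fun i => if i ∈ I then δ else 0)

/-- The coefficient of `T_x^{μδ}` in `H_{|μ|}`:
`∏_{i < j} [x_i - x_j + (μ_i - μ_j)δ] / [x_i - x_j] ·
  ∏_{i, j} ∏_{0 ≤ k < μ_i} [x_i - x_j + κ + kδ] / [x_i - x_j + δ + kδ]`. -/
def coeffH {φ : ℂ → ℂ} (hφ : Differentiable ℂ φ) (δ κ : ℂ) {n : ℕ} (μ : Fin n → ℕ) : Mero n :=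
  (∏ i, ∏ j ∈ Finset.Ioi i, brk hφ i j (((μ i : ℂ) - (μ j : ℂ)) * δ) / brk hφ i j 0) *
    ∏ i, ∏ j, ∏ k ∈ Finset.range (μ i),
      brk hφ i j (κ + (k : ℂ) * δ) / brk hφ i j (δ + (k : ℂ) * δ)

/-- The operator `H_l`, the sum over all `μ ∈ ℕⁿ` with `μ_1 + ⋯ + μ_n = l` of
`coeffH μ · T_x^{μδ}`. -/
def H {φ : ℂ → ℂ} (hφ : Differentiable ℂ φ) (δ κ : ℂ) (n l : ℕ) : Op n :=
  ∑ μ ∈ Finset.piAntidiag (Finset.univ : Finset (Fin n)) l,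
    mulOp (coeffH hφ δ κ μ) * T (fun i => (μ i : ℂ) * δ)

/-- The algebra `ℂ[D_1, …, D_n]` of Ruijsenaars operators, that is the `ℂ`-algebra of operators
generated by `D_1, …, D_n`. -/
def ruijsenaarsAlgebra {φ : ℂ → ℂ} (hφ : Differentiable ℂ φ) (δ κ : ℂ) (n : ℕ) :
    Subalgebra ℂ (Op n) :=
  Algebra.adjoin ℂ (D hφ δ κ n '' Set.Icc 1 n)

end

end Ruijsenaars

/-!
Both the commutativity of the `D_r` and the expression of the `H_l` by the `D_r` come down to
identities between finite sums of products of brackets `[x_i - x_j + c]`, one for each coefficient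
of a shift `T_x^v`.

The only input about the bracket is the three-term relation. It makes `[z]` odd, and it is the case
of two nodes of a Lagrange interpolation formula for products `[z - a_1] ⋯ [z - a_N]` with fixed
`a_1 + ⋯ + a_N` (`IsBracket.interpolation`). Consequently, linear combinations of such products
(the spaces `theta φ N s`) behave like sections of a line bundle of degree `N` on an elliptic
curve: an element is zero if it vanishes at `N` distinct points whose sum is not congruent to `s`
(`IsBracket.theta_eq_zero`), and it is determined up to a constant by `N` zeros with sum `s`
(`IsBracket.theta_eq_const_mul`). This replaces Liouville's theorem, and no classification of the
possible brackets is needed.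

*Commutativity.* Fix `C = I ∩ J` and the symmetric difference `S` of `I` and `J`. The coefficients
of `D_r D_s` and `D_s D_r` then differ only by the sums over the splittings of `S` into two parts
in the two orders. Their equality is `IsBracket.splitSum_eq`. The difference of the two sums, as a
function of one variable `x_a`, has no poles: those at `x_a = x_j` cancel in pairs, and the residues
at `x_a = x_j ± δ` are multiples of the same difference for the variables other than `x_a, x_j`,
which vanishes by induction. Hence the difference is constant. It changes sign under `x ↦ -x`, so
it is zero.

*Wronski relation.* The operators satisfy `∑_{r+s=k} (-1)^r [rκ + sδ] D_r H_s = 0`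
(`wronski_relation`). The coefficient of `T_x^{νδ}` is a sum over the subsets of the support of `ν`,
and it is a specialization of `IsBracket.wronskiSum_eq_zero`, an identity in two sets of variables
`x, y` of equal size. That identity is proved by induction: as a function of one `y_a`, the sum
vanishes at `y_a = -x_m` and `y_a = -x_m - t`, where it reduces to the sum without `y_a` and `x_m`,
and these are more zeros than its degree allows. As `[kδ] ≠ 0`, the relation expresses `H_k`
through the `D_r` and the `H_s` with `s < k`, so all `H_k` lie in the commutative algebra generated
by the `D_r`.
-/

namespace Ruijsenaars

/-! ### Elementary properties of the bracket, and interpolation -/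

/-- An entire function `φ`, not identically zero, that satisfies the three-term relation. -/
structure IsBracket (φ : ℂ → ℂ) : Prop where
  differentiable : Differentiable ℂ φ
  ne_zero : φ ≠ 0
  hirota : ∀ z α β γ : ℂ,
      φ (z + α) * φ (z - α) * (φ (β + γ) * φ (β - γ)) +
        φ (z + β) * φ (z - β) * (φ (γ + α) * φ (γ - α)) +
        φ (z + γ) * φ (z - γ) * (φ (α + β) * φ (α - β)) = 0

namespace IsBracket

variable {φ : ℂ → ℂ} (h : IsBracket φ)
include h

lemma continuous : Continuous φ := h.differentiable.continuous

lemma map_zero : φ 0 = 0 := by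
  have := h.hirota 0 0 0 0
  simp only [add_zero, sub_zero] at this
  have h3 : 3 * φ 0 ^ 4 = 0 := by linear_combination this
  simpa using h3

lemma map_neg (u : ℂ) : φ (-u) = -φ u := by
  obtain ⟨z, hz⟩ := Function.ne_iff.mp h.ne_zero
  have hz : φ z ≠ 0 := hz
  have key : ∀ v, φ v * (φ v + φ (-v)) = 0 := fun v => by
    have := h.hirota z v 0 0
    simp only [add_zero, sub_zero, zero_sub, zero_add, h.map_zero, mul_zero] at this
    have h2 : φ z * φ z * (φ v * (φ v + φ (-v))) = 0 := by linear_combination this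
    simpa [hz] using h2
  have h1 := key u
  have h2 := key (-u)
  rw [neg_neg] at h2
  rcases mul_eq_zero.mp h1 with h0 | h0
  · rw [h0, add_zero] at h2
    rw [h0, mul_self_eq_zero.mp h2, neg_zero]
  · linear_combination h0

lemma map_sub_swap (u v : ℂ) : φ (u - v) = -φ (v - u) := by
  rw [← h.map_neg, neg_sub]

/-- Interpolation with two nodes, which is the three-term relation in other coordinates. -/
lemma two_nodes (z a b c d : ℂ) :
    φ (c + d - a - b) * φ (c - d) * (φ (z - a) * φ (z - b)) =
      φ (z + d - a - b) * φ (z - d) * (φ (c - a) * φ (c - b)) -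
        φ (z + c - a - b) * φ (z - c) * (φ (d - a) * φ (d - b)) := by
  have := h.hirota (z - (a + b) / 2) ((b - a) / 2) (d - (a + b) / 2) (c - (a + b) / 2)
  rw [show z - (a + b) / 2 + (b - a) / 2 = z - a by ring,
    show z - (a + b) / 2 - (b - a) / 2 = z - b by ring,
    show d - (a + b) / 2 + (c - (a + b) / 2) = c + d - a - b by ring,
    show d - (a + b) / 2 - (c - (a + b) / 2) = -(c - d) by ring,
    show z - (a + b) / 2 + (d - (a + b) / 2) = z + d - a - b by ring,
    show z - (a + b) / 2 - (d - (a + b) / 2) = z - d by ring,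
    show c - (a + b) / 2 + (b - a) / 2 = c - a by ring,
    show c - (a + b) / 2 - (b - a) / 2 = c - b by ring,
    show z - (a + b) / 2 + (c - (a + b) / 2) = z + c - a - b by ring,
    show z - (a + b) / 2 - (c - (a + b) / 2) = z - c by ring,
    show (b - a) / 2 + (d - (a + b) / 2) = d - a by ring,
    show (b - a) / 2 - (d - (a + b) / 2) = -(d - b) by ring, h.map_neg, h.map_neg] at this
  linear_combination -this

/-- The zeros of a bracket are isolated. -/
lemma dense_ne {a : ℂ} (ha : a ≠ 0) (b : ℂ) : Dense {z | φ (a * z + b) ≠ 0} := by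
  intro z
  by_contra hz
  rw [mem_closure_iff_frequently, Filter.not_frequently] at hz
  have hψ : AnalyticOnNhd ℂ (fun z => φ (a * z + b)) Set.univ := fun x _ =>
    (h.differentiable.comp (by fun_prop : Differentiable ℂ fun z => a * z + b)).analyticAt x
  have h0 : (fun z => φ (a * z + b)) = fun _ => 0 :=
    hψ.eq_of_eventuallyEq (z₀ := z) (fun _ _ => analyticAt_const)
      (hz.mono fun w hw => by simpa using hw)
  refine h.ne_zero (funext fun w => ?_)
  have := congrFun h0 ((w - b) / a)
  simpa [mul_div_cancel₀ _ ha] using this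

lemma dense_forall_ne {ι : Type*} (s : Finset ι) (a b : ι → ℂ) (ha : ∀ i ∈ s, a i ≠ 0) :
    Dense {z | ∀ i ∈ s, φ (a i * z + b i) ≠ 0} := by
  classical
  have hc := h.continuous
  induction s using Finset.induction_on with
  | empty => simp
  | insert i s hi ih =>
    have h1 := h.dense_ne (ha i (by simp)) (b i)
    have h2 := ih fun j hj => ha j (by simp [hj])
    have h3 := h1.inter_of_isOpen_left h2 (isOpen_ne_fun (by fun_prop) continuous_const)
    convert h3 using 1
    ext z
    simp

/-- An identity between continuous functions of `z` may be checked where finitely many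
brackets of nonconstant affine functions of `z` do not vanish. -/
lemma eq_zero_of_generic {ι : Type*} (s : Finset ι) (a b : ι → ℂ) (ha : ∀ i ∈ s, a i ≠ 0)
    {E : ℂ → ℂ} (hE : Continuous E)
    (H : ∀ z, (∀ i ∈ s, φ (a i * z + b i) ≠ 0) → E z = 0) (z : ℂ) : E z = 0 := by
  have := hE.ext_on (h.dense_forall_ne s a b ha) continuous_const (g := fun _ => 0)
    fun z hz => H z hz
  exact congrFun this z

lemma exists_generic {ι : Type*} (s : Finset ι) (a b : ι → ℂ) (ha : ∀ i ∈ s, a i ≠ 0) :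
    ∃ z, ∀ i ∈ s, φ (a i * z + b i) ≠ 0 :=
  (h.dense_forall_ne s a b ha).nonempty

/-- Lagrange interpolation for products of brackets: with nodes `c i`, `i ∈ J`, and
`λ = ∑ c - ∑ m`, the product `∏_{a ∈ m} [z - a]` is determined by its values at the nodes, when
`m` has as many elements as `J`. -/
lemma interpolation {ι : Type*} [DecidableEq ι] {J : Finset ι} (hJ : J.Nonempty) (c : ι → ℂ)
    (m : Multiset ℂ) (hm : m.card = J.card)
    (hc : ∀ i ∈ J, ∀ j ∈ J, i ≠ j → φ (c i - c j) ≠ 0) (z : ℂ) :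
    φ (∑ i ∈ J, c i - m.sum) * (m.map fun a => φ (z - a)).prod =
      ∑ i ∈ J, φ (z - c i + (∑ i ∈ J, c i - m.sum)) * (m.map fun a => φ (c i - a)).prod *
        ∏ j ∈ J.erase i, φ (z - c j) / φ (c i - c j) := by
  induction hJ using Finset.Nonempty.cons_induction generalizing m z with
  | singleton k =>
    obtain ⟨a, rfl⟩ := Multiset.card_eq_one.mp (by simpa using hm)
    simp
    ring_nf
  | cons k J hk hJ ih =>
    have hc' : ∀ i ∈ J, ∀ j ∈ J, i ≠ j → φ (c i - c j) ≠ 0 := fun i hi j hj =>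
      hc i (by simp [hi]) j (by simp [hj])
    have hck : ∀ i ∈ J, φ (c i - c k) ≠ 0 := fun i hi =>
      hc i (by simp [hi]) k (by simp) (by rintro rfl; exact hk hi)
    have hkc : ∀ i ∈ J, φ (c k - c i) ≠ 0 := fun i hi =>
      hc k (by simp) i (by simp [hi]) (by rintro rfl; exact hk hi)
    -- the inductive step, under a condition that makes it possible to cancel a factor
    have step : ∀ (a : ℂ) (m : Multiset ℂ), m.card = J.card → φ (∑ i ∈ J, c i - m.sum) ≠ 0 →
        φ (∑ i ∈ J.cons k hk, c i - (a ::ₘ m).sum) * ((a ::ₘ m).map fun a => φ (z - a)).prod =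
          ∑ i ∈ J.cons k hk, φ (z - c i + (∑ i ∈ J.cons k hk, c i - (a ::ₘ m).sum)) *
            ((a ::ₘ m).map fun a => φ (c i - a)).prod *
            ∏ j ∈ (J.cons k hk).erase i, φ (z - c j) / φ (c i - c j) := by
      intro a m hm hl
      have ihz := ih m hm hc' z
      have ihk := ih m hm hc' (c k)
      rw [Finset.sum_cons, Finset.sum_cons, Multiset.sum_cons, Finset.erase_cons]
      set l := ∑ i ∈ J, c i - m.sum with hldef
      have e1 : c k + ∑ i ∈ J, c i - (a + m.sum) = l + c k - a := by rw [hldef]; ring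
      rw [e1]
      simp only [Multiset.map_cons, Multiset.prod_cons]
      have e2 : ∀ i ∈ J, ∏ j ∈ (J.cons k hk).erase i, φ (z - c j) / φ (c i - c j) =
          φ (z - c k) / φ (c i - c k) * ∏ j ∈ J.erase i, φ (z - c j) / φ (c i - c j) := by
        intro i hi
        rw [Finset.erase_cons_of_ne hk (by rintro rfl; exact hk hi), Finset.prod_cons]
      rw [Finset.sum_congr rfl fun i hi => by rw [e2 i hi]]
      refine mul_left_cancel₀ hl ?_
      have e3 : ∀ i ∈ J, φ (l + c k - a) * φ (z - c i + l) * φ (z - a) =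
          φ l * φ (z - c i + (l + c k - a)) * φ (c i - a) * (φ (z - c k) / φ (c i - c k)) +
          φ (z - c k + (l + c k - a)) * φ (c k - a) * φ (c k - c i + l) *
            (φ (z - c i) / φ (c k - c i)) := by
        intro i hi
        have h2 := h.two_nodes z a (c i - l) (c i) (c k)
        rw [show c i + c k - a - (c i - l) = l + c k - a by ring,
          show z - (c i - l) = z - c i + l by ring,
          show z + c k - a - (c i - l) = z - c i + (l + c k - a) by ring,
          show c i - (c i - l) = l by ring,
          show z + c i - a - (c i - l) = z - c k + (l + c k - a) by ring,
          show c k - (c i - l) = c k - c i + l by ring] at h2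
        have h3 := hck i hi
        rw [h.map_sub_swap (c k) (c i)]
        field_simp
        linear_combination h2
      have e4 : ∀ i ∈ J, φ (z - c i) / φ (c k - c i) *
          ∏ j ∈ J.erase i, φ (z - c j) / φ (c i - c j) =
          (∏ j ∈ J, φ (z - c j) / φ (c k - c j)) *
            ∏ j ∈ J.erase i, φ (c k - c j) / φ (c i - c j) := by
        intro i hi
        rw [← Finset.mul_prod_erase J _ hi, mul_assoc, ← Finset.prod_mul_distrib]
        congr 1
        refine Finset.prod_congr rfl fun j hj => ?_
        have := hkc j (Finset.mem_of_mem_erase hj)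
        field_simp
      calc φ l * (φ (l + c k - a) * (φ (z - a) * (m.map fun a => φ (z - a)).prod))
          = φ (l + c k - a) * φ (z - a) * (φ l * (m.map fun a => φ (z - a)).prod) := by ring
        _ = ∑ i ∈ J, φ (l + c k - a) * φ (z - c i + l) * φ (z - a) *
              ((m.map fun a => φ (c i - a)).prod *
                ∏ j ∈ J.erase i, φ (z - c j) / φ (c i - c j)) := by
            rw [ihz, Finset.mul_sum]
            refine Finset.sum_congr rfl fun i _ => ?_
            ring
        _ = ∑ i ∈ J, (φ (z - c k + (l + c k - a)) * φ (c k - a) *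
              (∏ j ∈ J, φ (z - c j) / φ (c k - c j)) *
              (φ (c k - c i + l) * (m.map fun a => φ (c i - a)).prod *
                ∏ j ∈ J.erase i, φ (c k - c j) / φ (c i - c j)) +
              φ l * (φ (z - c i + (l + c k - a)) *
                (φ (c i - a) * (m.map fun a => φ (c i - a)).prod) *
                (φ (z - c k) / φ (c i - c k) *
                  ∏ j ∈ J.erase i, φ (z - c j) / φ (c i - c j)))) := by
            refine Finset.sum_congr rfl fun i hi => ?_
            rw [e3 i hi]
            linear_combination (φ (z - c k + (l + c k - a)) * φ (c k - a) * φ (c k - c i + l) *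
              (m.map fun a => φ (c i - a)).prod) * e4 i hi
        _ = _ := by
            rw [Finset.sum_add_distrib, ← Finset.mul_sum, ← ihk, ← Finset.mul_sum]
            ring
    obtain ⟨a, m, rfl⟩ : ∃ a m', m = a ::ₘ m' := by
      obtain ⟨a, ha⟩ := Multiset.card_pos_iff_exists_mem.mp (by rw [hm]; simp : 0 < m.card)
      exact ⟨a, _, (Multiset.cons_erase ha).symm⟩
    have hmJ : m.card = J.card := by
      rw [Multiset.card_cons, Finset.card_cons] at hm
      omega
    obtain ⟨b, m, rfl⟩ : ∃ b m', m = b ::ₘ m' := by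
      obtain ⟨a, ha⟩ := Multiset.card_pos_iff_exists_mem.mp
        (by rw [hmJ]; exact hJ.card_pos : 0 < m.card)
      exact ⟨a, _, (Multiset.cons_erase ha).symm⟩
    -- move `a` and `b` in opposite directions; then the condition holds generically
    have hcont := h.continuous
    have key := h.eq_zero_of_generic {()} (fun _ => -1) (fun _ => ∑ i ∈ J, c i - (b + m.sum))
      (by simp)
      (E := fun e => φ (∑ i ∈ J.cons k hk, c i - (a + (b + m.sum))) *
          (φ (z - (a - e)) * (φ (z - (b + e)) * (m.map fun a => φ (z - a)).prod)) -
          ∑ i ∈ J.cons k hk, φ (z - c i + (∑ i ∈ J.cons k hk, c i - (a + (b + m.sum)))) *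
            (φ (c i - (a - e)) * (φ (c i - (b + e)) * (m.map fun a => φ (c i - a)).prod)) *
            ∏ j ∈ (J.cons k hk).erase i, φ (z - c j) / φ (c i - c j))
      (by fun_prop) (fun e he => by
        have h1 := step (a - e) ((b + e) ::ₘ m) (by simpa using hmJ) (by
          have := he () (by simp)
          rw [Multiset.sum_cons]
          convert this using 2
          ring)
        simp only [Multiset.map_cons, Multiset.prod_cons, Multiset.sum_cons] at h1
        rw [show a - e + (b + e + m.sum) = a + (b + m.sum) by ring] at h1
        rw [h1, sub_self]) 0
    simp only [sub_zero, add_zero] at key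
    simpa using sub_eq_zero.mp key

end IsBracket

/-! ### Spaces of theta functions -/

/-- `theta φ N s` is the space of functions of `z` spanned by the products
`[z - a₁] ⋯ [z - a_N]` with `a₁ + ⋯ + a_N = s`. -/
def theta (φ : ℂ → ℂ) (N : ℕ) (s : ℂ) : Submodule ℂ (ℂ → ℂ) :=
  Submodule.span ℂ {f | ∃ m : Multiset ℂ, m.card = N ∧ m.sum = s ∧
    f = fun z => (m.map fun a => φ (z - a)).prod}

lemma theta_one (φ : ℂ → ℂ) (a : ℂ) : (fun z => φ (z - a)) ∈ theta φ 1 a :=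
  Submodule.subset_span ⟨{a}, by simp, by simp, by simp⟩

lemma theta_mul {φ : ℂ → ℂ} {f g : ℂ → ℂ} {M N : ℕ} {s t : ℂ} (hf : f ∈ theta φ M s)
    (hg : g ∈ theta φ N t) : (fun z => f z * g z) ∈ theta φ (M + N) (s + t) := by
  induction hf using Submodule.span_induction with
  | zero =>
    convert (theta φ (M + N) (s + t)).zero_mem using 1
    ext z
    simp
  | add x y _ _ hx hy =>
    convert add_mem hx hy using 1
    ext z
    simp [add_mul]
  | smul a x _ hx =>
    convert (theta φ (M + N) (s + t)).smul_mem a hx using 1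
    ext z
    simp [mul_assoc]
  | mem f hf =>
    obtain ⟨m, rfl, rfl, rfl⟩ := hf
    induction hg using Submodule.span_induction with
    | zero =>
      convert (theta φ _ _).zero_mem using 1
      ext z
      simp
    | add x y _ _ hx hy =>
      convert add_mem hx hy using 1
      ext z
      simp [mul_add]
    | smul a x _ hx =>
      convert (theta φ _ _).smul_mem a hx using 1
      ext z
      simp [mul_left_comm]
    | mem g hg =>
      obtain ⟨n, rfl, rfl, rfl⟩ := hg
      exact Submodule.subset_span ⟨m + n, by simp, by simp, by simp⟩

lemma theta_prod {φ : ℂ → ℂ} {ι : Type*} (J : Finset ι) (f : ι → ℂ → ℂ) (N : ι → ℕ) (s : ι → ℂ)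
    (hf : ∀ i ∈ J, f i ∈ theta φ (N i) (s i)) :
    (fun z => ∏ i ∈ J, f i z) ∈ theta φ (∑ i ∈ J, N i) (∑ i ∈ J, s i) := by
  classical
  induction J using Finset.induction_on with
  | empty => exact Submodule.subset_span ⟨0, by simp, by simp, by simp⟩
  | insert i J hi ih =>
    simp only [Finset.sum_insert hi, Finset.prod_insert hi]
    exact theta_mul (hf i (by simp)) (ih fun j hj => hf j (by simp [hj]))

lemma theta_const_mul {φ : ℂ → ℂ} {f : ℂ → ℂ} {N : ℕ} {s : ℂ} (a : ℂ) (hf : f ∈ theta φ N s) :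
    (fun z => a * f z) ∈ theta φ N s :=
  (theta φ N s).smul_mem a hf

lemma theta_sum {φ : ℂ → ℂ} {ι : Type*} (J : Finset ι) (f : ι → ℂ → ℂ) {N : ℕ} {s : ℂ}
    (hf : ∀ i ∈ J, f i ∈ theta φ N s) : (fun z => ∑ i ∈ J, f i z) ∈ theta φ N s := by
  convert (theta φ N s).sum_mem hf using 1
  ext z
  simp

namespace IsBracket
variable {φ : ℂ → ℂ} (h : IsBracket φ)
include h

/-- An element of `theta φ N s` that vanishes at `N` distinct points, whose sum is not congruent
to `s`, is zero. -/
lemma theta_eq_zero {ι : Type*} {J : Finset ι} (hJ : J.Nonempty) (c : ι → ℂ) {s : ℂ}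
    {f : ℂ → ℂ} (hf : f ∈ theta φ J.card s)
    (hc : ∀ i ∈ J, ∀ j ∈ J, i ≠ j → φ (c i - c j) ≠ 0) (hs : φ (∑ i ∈ J, c i - s) ≠ 0)
    (h0 : ∀ i ∈ J, f (c i) = 0) (z : ℂ) : f z = 0 := by
  classical
  have key : φ (∑ i ∈ J, c i - s) * f z = ∑ i ∈ J, φ (z - c i + (∑ i ∈ J, c i - s)) * f (c i) *
      ∏ j ∈ J.erase i, φ (z - c j) / φ (c i - c j) := by
    clear h0
    induction hf using Submodule.span_induction with
    | zero => simp
    | add x y _ _ hx hy => simp [mul_add, add_mul, Finset.sum_add_distrib, hx, hy]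
    | smul a x _ hx =>
      simp only [Pi.smul_apply, smul_eq_mul]
      rw [mul_left_comm, hx, Finset.mul_sum]
      exact Finset.sum_congr rfl fun i _ => by ring
    | mem f hf =>
      obtain ⟨m, hm, rfl, rfl⟩ := hf
      exact h.interpolation hJ c m hm hc z
  have h1 : ∀ i ∈ J, φ (z - c i + (∑ i ∈ J, c i - s)) * f (c i) *
      ∏ j ∈ J.erase i, φ (z - c j) / φ (c i - c j) = 0 := fun i hi => by rw [h0 i hi]; ring
  rw [Finset.sum_eq_zero h1] at key
  exact (mul_eq_zero.mp key).resolve_left hs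

/-- An element of `theta φ N s` that vanishes at `N` distinct points `c i` with sum `s` is a
multiple of `∏ [z - c i]`. -/
lemma theta_eq_const_mul {ι : Type*} {J : Finset ι} (hJ : J.Nonempty) (c : ι → ℂ)
    {f : ℂ → ℂ} (hf : f ∈ theta φ J.card (∑ i ∈ J, c i))
    (hc : ∀ i ∈ J, ∀ j ∈ J, i ≠ j → φ (c i - c j) ≠ 0)
    (h0 : ∀ i ∈ J, f (c i) = 0) (z w : ℂ) (hw : ∀ i ∈ J, φ (w - c i) ≠ 0) :
    f z * ∏ i ∈ J, φ (w - c i) = f w * ∏ i ∈ J, φ (z - c i) := by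
  classical
  obtain ⟨k, hk⟩ := hJ
  have hD : (fun z => ∏ i ∈ J, φ (z - c i)) ∈ theta φ J.card (∑ i ∈ J, c i) := by
    have := theta_prod J (fun i z => φ (z - c i)) (fun _ => 1) c fun i _ => theta_one φ (c i)
    simpa using this
  have he : (fun z => (∏ i ∈ J, φ (w - c i)) * f z + -f w * ∏ i ∈ J, φ (z - c i)) ∈
      theta φ J.card (∑ i ∈ J, c i) :=
    add_mem (theta_const_mul _ hf) (theta_const_mul _ hD)
  -- replace the node `c k` by `w`
  have := h.theta_eq_zero ⟨k, hk⟩ (Function.update c k w) he (fun i hi j hj hij => by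
      by_cases hik : i = k
      · subst hik
        simpa [Function.update_of_ne hij.symm] using hw j hj
      · by_cases hjk : j = k
        · subst hjk
          rw [Function.update_of_ne hij, Function.update_self, h.map_sub_swap]
          exact neg_ne_zero.mpr (hw i hi)
        · rw [Function.update_of_ne hik, Function.update_of_ne hjk]
          exact hc i hi j hj hij)
    (by
      rw [Finset.sum_update_of_mem hk, ← Finset.add_sum_erase J c hk,
        Finset.sdiff_singleton_eq_erase,
        add_sub_add_right_eq_sub]
      exact hw k hk)
    (fun i hi => by
      by_cases hik : i = k
      · subst hik
        simp only [Function.update_self]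
        ring
      · have h1 : ∏ j ∈ J, φ (c i - c j) = 0 :=
          Finset.prod_eq_zero hi (by rw [sub_self, h.map_zero])
        simp only [Function.update_of_ne hik, h0 i hi, h1, mul_zero, add_zero]) z
  linear_combination this

end IsBracket

/-! ### The identity behind the Wronski relation -/

/-- The sum over subsets `I ⊆ S` whose vanishing for `#S = #R` gives the Wronski relation; the
variables are `x i`, `i ∈ S`, and `y k`, `k ∈ R`. -/
noncomputable def wronskiSum {ι : Type*} [DecidableEq ι] (φ : ℂ → ℂ) (S R : Finset ι) (x y : ι → ℂ)
    (t : ℂ) : ℂ :=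
  ∑ I ∈ S.powerset, (-1) ^ I.card * φ (∑ i ∈ S, x i + ∑ k ∈ R, y k + I.card * t) *
    (∏ i ∈ I, ∏ j ∈ S \ I, φ (x i - x j + t) / φ (x i - x j)) *
    (∏ i ∈ I, ∏ k ∈ R, φ (x i + y k)) * ∏ i ∈ S \ I, ∏ k ∈ R, φ (x i + y k + t)

/-- As a function of one of the `y k`, the sum `wronskiSum` lies in a space `theta`. -/
lemma wronskiSum_mem_theta {ι : Type*} [DecidableEq ι] (φ : ℂ → ℂ) (S : Finset ι)
    {R : Finset ι} {a : ι} (ha : a ∉ R) (x y : ι → ℂ) (t : ℂ) : (fun z => wronskiSum φ S (insert a R) x (Function.update y a z) t) ∈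
      theta φ (1 + S.card) (-(2 * ∑ i ∈ S, x i) - ∑ k ∈ R, y k - S.card * t) := by
  have e : (fun z => wronskiSum φ S (insert a R) x (Function.update y a z) t) = fun z =>
      ∑ I ∈ S.powerset, ((-1) ^ I.card *
        (∏ i ∈ I, ∏ j ∈ S \ I, φ (x i - x j + t) / φ (x i - x j)) *
        (∏ i ∈ I, ∏ k ∈ R, φ (x i + y k)) * ∏ i ∈ S \ I, ∏ k ∈ R, φ (x i + y k + t)) *
        (φ (z - -(∑ i ∈ S, x i + ∑ k ∈ R, y k + I.card * t)) *
          ∏ i ∈ S, φ (z - if i ∈ I then -x i else -x i - t)) := by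
    ext z
    unfold wronskiSum
    refine Finset.sum_congr rfl fun I hI => ?_
    have hIS := Finset.mem_powerset.mp hI
    have hu : ∀ k ∈ R, Function.update y a z k = y k := fun k hk =>
      Function.update_of_ne (by rintro rfl; exact ha hk) _ _
    rw [Finset.sum_insert ha, Finset.sum_congr rfl hu]
    simp only [Finset.prod_insert ha, Function.update_self]
    simp only [Finset.prod_mul_distrib]
    rw [Finset.prod_congr rfl fun i (_ : i ∈ I) =>
        (Finset.prod_congr rfl fun k hk => by rw [hu k hk] :
          ∏ k ∈ R, φ (x i + Function.update y a z k) = ∏ k ∈ R, φ (x i + y k)),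
      Finset.prod_congr rfl fun i (_ : i ∈ S \ I) =>
        (Finset.prod_congr rfl fun k hk => by rw [hu k hk] :
          ∏ k ∈ R, φ (x i + Function.update y a z k + t) = ∏ k ∈ R, φ (x i + y k + t)),
      ← Finset.prod_sdiff hIS (f := fun i => φ (z - if i ∈ I then -x i else -x i - t)),
      Finset.prod_congr rfl fun i (hi : i ∈ I) =>
        (by rw [if_pos hi]; congr 1; ring : φ (z - if i ∈ I then -x i else -x i - t) =
          φ (x i + z)),
      Finset.prod_congr rfl fun i (hi : i ∈ S \ I) =>
        (by rw [if_neg (Finset.mem_sdiff.mp hi).2]; congr 1; ring :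
          φ (z - if i ∈ I then -x i else -x i - t) = φ (x i + z + t)),
      show z - -(∑ i ∈ S, x i + ∑ k ∈ R, y k + I.card * t) =
        ∑ i ∈ S, x i + (z + ∑ k ∈ R, y k) + I.card * t by ring]
    ring
  rw [e]
  refine theta_sum _ _ fun I hI => theta_const_mul _ ?_
  have hIS := Finset.mem_powerset.mp hI
  convert theta_mul (theta_one φ (-(∑ i ∈ S, x i + ∑ k ∈ R, y k + I.card * t)))
    (theta_prod S (fun i z => φ (z - if i ∈ I then -x i else -x i - t)) (fun _ => 1) _
      fun i _ => theta_one φ _) using 1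
  congr 1
  · simp
  · rw [← Finset.sum_sdiff hIS (f := fun i => if i ∈ I then -x i else -x i - t),
      Finset.sum_congr rfl fun i (hi : i ∈ I) => if_pos hi,
      Finset.sum_congr rfl fun i (hi : i ∈ S \ I) => if_neg (Finset.mem_sdiff.mp hi).2,
      ← Finset.sum_sdiff hIS (f := x), Finset.sum_sub_distrib, Finset.sum_neg_distrib,
      Finset.sum_neg_distrib, Finset.sum_const, nsmul_eq_mul,
      Finset.card_sdiff_of_subset hIS, Nat.cast_sub (Finset.card_le_card hIS)]
    ring

namespace IsBracket
variable {φ : ℂ → ℂ} (h : IsBracket φ) {ι : Type*} [DecidableEq ι]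
include h

/-- At `y a = -x m` only the subsets without `m` contribute, and the sum is a multiple of the one
without `x m` and `y a`. -/
lemma wronskiSum_insert_of_eq_neg {S R : Finset ι} {m a : ι} (hm : m ∉ S) (ha : a ∉ R)
    (x y : ι → ℂ) (t : ℂ) (hx : ∀ i ∈ S, φ (x i - x m) ≠ 0) (hy : y a = -x m) :
    wronskiSum φ (insert m S) (insert a R) x y t =
      φ t * (∏ k ∈ R, φ (x m + y k + t)) * (∏ i ∈ S, φ (x i - x m + t)) *
        wronskiSum φ S R x y t := by
  unfold wronskiSum
  have h0 : ∀ I ∈ S.powerset, (-1) ^ (insert m I).card *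
      φ (∑ i ∈ insert m S, x i + ∑ k ∈ insert a R, y k + (insert m I).card * t) *
      (∏ i ∈ insert m I, ∏ j ∈ insert m S \ insert m I, φ (x i - x j + t) / φ (x i - x j)) *
      (∏ i ∈ insert m I, ∏ k ∈ insert a R, φ (x i + y k)) *
      ∏ i ∈ insert m S \ insert m I, ∏ k ∈ insert a R, φ (x i + y k + t) = 0 := fun I _ => by
    have : ∏ i ∈ insert m I, ∏ k ∈ insert a R, φ (x i + y k) = 0 :=
      Finset.prod_eq_zero (Finset.mem_insert_self m I)
        (Finset.prod_eq_zero (Finset.mem_insert_self a R) (by rw [hy, add_neg_cancel, h.map_zero]))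
    rw [this]
    ring
  rw [Finset.sum_powerset_insert hm, Finset.sum_eq_zero h0, add_zero, Finset.mul_sum]
  refine Finset.sum_congr rfl fun I hI => ?_
  have hIS := Finset.mem_powerset.mp hI
  have hmI : m ∉ I := fun hh => hm (hIS hh)
  rw [Finset.insert_sdiff_of_notMem S hmI, Finset.sum_insert hm, Finset.sum_insert ha,
    Finset.prod_insert (by simp [hm])]
  simp only [Finset.prod_insert ha, hy]
  rw [Finset.prod_congr rfl fun i _ => Finset.prod_insert (by simp [hm] : m ∉ S \ I)]
  simp only [Finset.prod_mul_distrib, Finset.prod_div_distrib]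
  rw [← Finset.prod_sdiff hIS (f := fun i => φ (x i - x m + t)),
    show x m + ∑ i ∈ S, x i + (-x m + ∑ k ∈ R, y k) = ∑ i ∈ S, x i + ∑ k ∈ R, y k by ring,
    show x m + -x m + t = t by ring]
  simp only [← sub_eq_add_neg]
  have h1 : ∏ i ∈ I, φ (x i - x m) ≠ 0 := Finset.prod_ne_zero_iff.mpr fun i hi => hx i (hIS hi)
  generalize (∏ i ∈ I, φ (x i - x m)) = b at h1 ⊢
  generalize (∏ i ∈ I, φ (x i - x m + t)) = b'
  generalize (∏ i ∈ I, ∏ j ∈ S \ I, φ (x i - x j + t)) /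
    (∏ i ∈ I, ∏ j ∈ S \ I, φ (x i - x j)) = c
  field_simp

/-- At `y a = -x m - t` only the subsets containing `m` contribute, and the sum is again a multiple
of the one without `x m` and `y a`. -/
lemma wronskiSum_insert_of_eq_neg_sub {S R : Finset ι} {m a : ι} (hm : m ∉ S) (ha : a ∉ R)
    (x y : ι → ℂ) (t : ℂ) (hx : ∀ i ∈ S, φ (x m - x i) ≠ 0) (hy : y a = -x m - t) :
    wronskiSum φ (insert m S) (insert a R) x y t =
      φ t * (∏ k ∈ R, φ (x m + y k)) * (∏ i ∈ S, -φ (x m - x i + t)) *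
        wronskiSum φ S R x y t := by
  unfold wronskiSum
  have h0 : ∀ I ∈ S.powerset, (-1) ^ I.card *
      φ (∑ i ∈ insert m S, x i + ∑ k ∈ insert a R, y k + I.card * t) *
      (∏ i ∈ I, ∏ j ∈ insert m S \ I, φ (x i - x j + t) / φ (x i - x j)) *
      (∏ i ∈ I, ∏ k ∈ insert a R, φ (x i + y k)) *
      ∏ i ∈ insert m S \ I, ∏ k ∈ insert a R, φ (x i + y k + t) = 0 := fun I hI => by
    have hmI : m ∉ I := fun hh => hm (Finset.mem_powerset.mp hI hh)
    rw [Finset.prod_eq_zero (Finset.mem_sdiff.mpr ⟨Finset.mem_insert_self m S, hmI⟩)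
      (Finset.prod_eq_zero (Finset.mem_insert_self a R)
        (by rw [hy, show x m + (-x m - t) + t = 0 by ring, h.map_zero]))]
    ring
  rw [Finset.sum_powerset_insert hm, Finset.sum_eq_zero h0, zero_add, Finset.mul_sum]
  refine Finset.sum_congr rfl fun I hI => ?_
  have hIS := Finset.mem_powerset.mp hI
  have hmI : m ∉ I := fun hh => hm (hIS hh)
  have e1 : insert m S \ insert m I = S \ I := by
    ext i
    simp only [Finset.mem_sdiff, Finset.mem_insert]
    constructor
    · tauto
    · rintro ⟨h1, h2⟩
      have : i ≠ m := by rintro rfl; exact hm h1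
      tauto
  rw [e1, Finset.sum_insert hm, Finset.sum_insert ha, Finset.card_insert_of_notMem hmI,
    Finset.prod_insert hmI, Finset.prod_insert hmI]
  simp only [Finset.prod_insert ha, hy]
  simp only [Finset.prod_mul_distrib, Finset.prod_div_distrib]
  rw [← Finset.prod_sdiff hIS (f := fun i => -φ (x m - x i + t)),
    show x m + ∑ i ∈ S, x i + (-x m - t + ∑ k ∈ R, y k) + ((I.card + 1 : ℕ) : ℂ) * t =
      ∑ i ∈ S, x i + ∑ k ∈ R, y k + I.card * t by push_cast; ring,
    show x m + (-x m - t) = -t by ring, h.map_neg,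
    Finset.prod_congr rfl fun i (_ : i ∈ I) =>
      (by rw [← h.map_neg]; congr 1; ring : φ (x i + (-x m - t)) = -φ (x m - x i + t)),
    Finset.prod_congr rfl fun i (_ : i ∈ S \ I) =>
      (by rw [← h.map_neg]; congr 1; ring : φ (x i + (-x m - t) + t) = -φ (x m - x i))]
  have h1 : ∏ i ∈ S \ I, φ (x m - x i) ≠ 0 :=
    Finset.prod_ne_zero_iff.mpr fun i hi => hx i (Finset.mem_sdiff.mp hi).1
  simp only [Finset.prod_neg]
  generalize (∏ i ∈ S \ I, φ (x m - x i)) = b at h1 ⊢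
  generalize (∏ i ∈ S \ I, φ (x m - x i + t)) = b'
  generalize (∏ i ∈ I, ∏ j ∈ S \ I, φ (x i - x j + t)) /
    (∏ i ∈ I, ∏ j ∈ S \ I, φ (x i - x j)) = c
  field_simp
  ring

/-- The identity behind the Wronski relation. -/
theorem wronskiSum_eq_zero {S R : Finset ι} (hSR : S.card = R.card) (x y : ι → ℂ) (t : ℂ)
    (hx : ∀ i ∈ S, ∀ j ∈ S, i ≠ j → φ (x i - x j) ≠ 0) : wronskiSum φ S R x y t = 0 := by
  induction R using Finset.induction_on generalizing S y t with
  | empty =>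
    obtain rfl : S = ∅ := by simpa using hSR
    simp [wronskiSum, h.map_zero]
  | insert a R ha ih =>
    rw [Finset.card_insert_of_notMem ha] at hSR
    obtain ⟨m₀, hm₀⟩ : S.Nonempty := Finset.card_pos.mp (by omega)
    -- the two kinds of values of `y a` for which the sum vanishes
    have hv : ∀ m ∈ S, ∀ z t, (z = -x m ∨ z = -x m - t) →
        wronskiSum φ S (insert a R) x (Function.update y a z) t = 0 := by
      intro m hm z t hz
      have hS := Finset.insert_erase hm
      have hne : ∀ i ∈ S.erase m, i ∈ S ∧ i ≠ m := fun i hi =>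
        ⟨Finset.mem_of_mem_erase hi, Finset.ne_of_mem_erase hi⟩
      have h0 := ih (S := S.erase m) (by rw [Finset.card_erase_of_mem hm]; omega)
        (Function.update y a z) t fun i hi j hj => hx i (hne i hi).1 j (hne j hj).1
      rw [← hS]
      rcases hz with hz | hz
      · rw [h.wronskiSum_insert_of_eq_neg (Finset.notMem_erase m S) ha _ _ _
          (fun i hi => hx i (hne i hi).1 m hm (hne i hi).2) (by simp [hz]), h0, mul_zero]
      · rw [h.wronskiSum_insert_of_eq_neg_sub (Finset.notMem_erase m S) ha _ _ _
          (fun i hi => hx m hm i (hne i hi).1 (hne i hi).2.symm) (by simp [hz]), h0, mul_zero]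
    rcases R.eq_empty_or_nonempty with rfl | hR
    -- for a single variable there is no generic choice of nodes, but the two terms cancel
    · obtain ⟨m, rfl⟩ := Finset.card_eq_one.mp (by simpa using hSR)
      simp only [wronskiSum]
      rw [← insert_empty_eq, Finset.sum_powerset_insert (by simp)]
      simp
      ring
    have hR1 : (1 : ℕ) ≤ R.card := hR.card_pos
    -- a generic `t` makes the points `-x m`, `m ∈ S`, and `-x m₀ - t` distinct
    refine h.eq_zero_of_generic
      (insert ((R.card : ℂ), ∑ i ∈ S, x i + ∑ k ∈ R, y k - x m₀)
        (S.image fun m => ((-1 : ℂ), x m - x m₀)))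
      Prod.fst Prod.snd ?_ (E := fun t => wronskiSum φ S (insert a R) x y t) ?_ ?_ t
    · intro p hp
      rcases Finset.mem_insert.mp hp with rfl | hp
      · exact Nat.cast_ne_zero.mpr (by omega)
      · obtain ⟨m, _, rfl⟩ := Finset.mem_image.mp hp
        simp
    · have := h.continuous
      unfold wronskiSum
      fun_prop
    · intro t ht
      have ht1 := ht _ (Finset.mem_insert_self _ _)
      have ht2 : ∀ m ∈ S, φ (-x m₀ - t - -x m) ≠ 0 := fun m hm => by
        convert ht _ (Finset.mem_insert_of_mem (Finset.mem_image_of_mem _ hm)) using 2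
        ring
      have hmem := wronskiSum_mem_theta φ S ha x y t
      have := h.theta_eq_zero (J := Finset.insertNone S) ⟨none, by simp⟩
        (fun o => o.elim (-x m₀ - t) fun m => -x m)
        (by rwa [Finset.card_insertNone, add_comm]) ?_ ?_ ?_ (y a)
      · simpa using this
      · rintro (_ | i) hi (_ | j) hj hij
        · exact absurd rfl hij
        · exact ht2 j (by simpa using hj)
        · change φ (-x i - (-x m₀ - t)) ≠ 0
          rw [h.map_sub_swap]
          exact neg_ne_zero.mpr (ht2 i (by simpa using hi))
        · convert hx j (by simpa using hj) i (by simpa using hi) (by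
            rintro rfl; exact hij rfl) using 2
          simp
          ring
      · rw [Finset.sum_insertNone]
        convert ht1 using 2
        simp [hSR]
        ring
      · rintro (_ | i) hi
        · exact hv m₀ hm₀ _ t (Or.inr rfl)
        · exact hv i (by simpa using hi) _ t (Or.inl rfl)

end IsBracket

/-! ### The splitting identity: poles and residues -/

section Definitions
variable {ι : Type*} (φ : ℂ → ℂ) (κ δ : ℂ)

/-- The factor that a pair of variables with difference `u` contributes to the coefficients of
`D_r D_s`. Reversing the sign of `u` amounts to reversing the signs of `κ` and `δ`. -/
noncomputable def pairFactor (u : ℂ) : ℂ :=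
  φ (u + κ) * φ (u + δ - κ) / (φ u * φ (u + δ))

/-- A common denominator of `pairFactor φ κ δ` and `pairFactor φ (-κ) (-δ)`. -/
def pairDenom (u : ℂ) : ℂ := φ u * φ (u + δ) * φ (u - δ)

/-- The numerator of `pairFactor φ κ δ` over the denominator `pairDenom φ δ`. -/
def pairNumer (u : ℂ) : ℂ := φ (u + κ) * φ (u + δ - κ) * φ (u - δ)

/-- The product of `pairFactor` over all pairs in `A × B`. -/
noncomputable def crossProd (x : ι → ℂ) (A B : Finset ι) : ℂ :=
  ∏ a ∈ A, ∏ b ∈ B, pairFactor φ κ δ (x a - x b)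

variable [DecidableEq ι]

/-- A weighted sum over all splittings of `S` in two parts. For the weight that selects the
cardinality `k` it is, up to a common factor, a coefficient of `D_r D_s`. -/
noncomputable def splitSum (S : Finset ι) (x : ι → ℂ) (w : ℕ → ℂ) : ℂ :=
  ∑ P ∈ S.powerset, w P.card * crossProd φ κ δ x P (S \ P)

/-- The numerator of `splitSum φ κ δ (insert a S) x w` as a function of `z = x a`, over the
denominator `∏ j ∈ S, pairDenom φ δ (z - x j)`. -/
noncomputable def splitNumer (S : Finset ι) (x : ι → ℂ) (w : ℕ → ℂ) (z : ℂ) : ℂ :=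
  ∑ P ∈ S.powerset, w P.card * crossProd φ κ δ x P (S \ P) *
      ((∏ p ∈ P, pairNumer φ (-κ) (-δ) (z - x p)) * ∏ q ∈ S \ P, pairDenom φ δ (z - x q)) +
    ∑ P ∈ S.powerset, w (P.card + 1) * crossProd φ κ δ x P (S \ P) *
      ((∏ p ∈ P, pairDenom φ δ (z - x p)) * ∏ q ∈ S \ P, pairNumer φ κ δ (z - x q))

/-- The variables `x i`, `i ∈ S`, have no differences at which a bracket degenerates. -/
def IsGeneric (S : Finset ι) (x : ι → ℂ) : Prop :=
  ∀ i ∈ S, ∀ j ∈ S, i ≠ j → ∀ k ∈ Finset.Icc (-2 : ℤ) 2, φ (x i - x j + k * δ) ≠ 0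

end Definitions

section Splitting

variable {ι : Type*} {φ : ℂ → ℂ} {κ δ : ℂ}

lemma pairDenom_neg (u : ℂ) : pairDenom φ (-δ) u = pairDenom φ δ u := by
  unfold pairDenom
  rw [sub_neg_eq_add, ← sub_eq_add_neg]
  ring

lemma pairFactor_mul_pairDenom {u : ℂ} (h0 : φ u ≠ 0) (h1 : φ (u + δ) ≠ 0) :
    pairFactor φ κ δ u * pairDenom φ δ u = pairNumer φ κ δ u := by
  unfold pairFactor pairDenom pairNumer
  field_simp

lemma theta_shift (u c : ℂ) : (fun z => φ (z - u + c)) ∈ theta φ 1 (u - c) := by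
  convert theta_one φ (u - c) using 3
  ring

lemma pairDenom_mem_theta (u : ℂ) : (fun z => pairDenom φ δ (z - u)) ∈ theta φ 3 (3 * u) := by
  convert theta_mul (theta_mul (theta_one φ u) (theta_shift (φ := φ) u δ))
    (theta_shift (φ := φ) u (-δ)) using 1
  · congr 1
    ring
  · ext z
    simp only [pairDenom, sub_eq_add_neg]

lemma pairNumer_mem_theta (u : ℂ) : (fun z => pairNumer φ κ δ (z - u)) ∈ theta φ 3 (3 * u) := by
  convert theta_mul (theta_mul (theta_shift (φ := φ) u κ) (theta_shift (φ := φ) u (δ - κ)))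
    (theta_shift (φ := φ) u (-δ)) using 1
  · congr 1
    ring
  · ext z
    simp only [pairNumer, sub_eq_add_neg, add_assoc]

lemma IsGeneric.mono {S T : Finset ι} {x : ι → ℂ} (hS : IsGeneric φ δ S x) (hT : T ⊆ S) :
    IsGeneric φ δ T x :=
  fun i hi j hj => hS i (hT hi) j (hT hj)

lemma IsGeneric.neg {S : Finset ι} {x : ι → ℂ} (hS : IsGeneric φ δ S x) :
    IsGeneric φ (-δ) S x := fun i hi j hj hij k hk => by
  have := hS i hi j hj hij (-k) (by simp only [Finset.mem_Icc] at hk ⊢; omega)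
  push_cast at this
  rwa [mul_neg, ← neg_mul]

lemma IsGeneric.ne_zero {S : Finset ι} {x : ι → ℂ} (hS : IsGeneric φ δ S x) {i j : ι}
    (hi : i ∈ S) (hj : j ∈ S) (hij : i ≠ j) : φ (x i - x j) ≠ 0 := by
  simpa using hS i hi j hj hij 0 (by simp)

lemma IsGeneric.add_ne_zero {S : Finset ι} {x : ι → ℂ} (hS : IsGeneric φ δ S x) {i j : ι}
    (hi : i ∈ S) (hj : j ∈ S) (hij : i ≠ j) : φ (x i - x j + δ) ≠ 0 := by
  simpa using hS i hi j hj hij 1 (by simp)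

lemma IsGeneric.sub_ne_zero {S : Finset ι} {x : ι → ℂ} (hS : IsGeneric φ δ S x) {i j : ι}
    (hi : i ∈ S) (hj : j ∈ S) (hij : i ≠ j) : φ (x i - x j - δ) ≠ 0 := by
  simpa [← sub_eq_add_neg] using hS i hi j hj hij (-1) (by simp)

variable [DecidableEq ι]

lemma crossProd_insert_left {x : ι → ℂ} {A B : Finset ι} {a : ι} (ha : a ∉ A) :
    crossProd φ κ δ x (insert a A) B =
      (∏ b ∈ B, pairFactor φ κ δ (x a - x b)) * crossProd φ κ δ x A B := by
  rw [crossProd, Finset.prod_insert ha, crossProd]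

lemma crossProd_insert_right {x : ι → ℂ} {A B : Finset ι} {b : ι} (hb : b ∉ B) :
    crossProd φ κ δ x A (insert b B) =
      (∏ a ∈ A, pairFactor φ κ δ (x a - x b)) * crossProd φ κ δ x A B := by
  simp only [crossProd, Finset.prod_insert hb, Finset.prod_mul_distrib]

lemma insert_sdiff_insert_of_notMem {S P : Finset ι} {a : ι} (ha : a ∉ S) :
    insert a S \ insert a P = S \ P := by
  ext i
  simp only [Finset.mem_sdiff, Finset.mem_insert]
  constructor
  · tauto
  · rintro ⟨h1, h2⟩
    have : i ≠ a := by rintro rfl; exact ha h1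
    tauto

lemma prod_mul_prod_sdiff_mem_theta {S P : Finset ι} (hP : P ⊆ S) {f g : ι → ℂ → ℂ} {N : ℕ}
    {s : ι → ℂ} (hf : ∀ i ∈ S, f i ∈ theta φ N (s i)) (hg : ∀ i ∈ S, g i ∈ theta φ N (s i)) :
    (fun z => (∏ p ∈ P, f p z) * ∏ q ∈ S \ P, g q z) ∈ theta φ (S.card * N) (∑ i ∈ S, s i) := by
  convert theta_mul (theta_prod P f (fun _ => N) s fun i hi => hf i (hP hi))
    (theta_prod (S \ P) g (fun _ => N) s fun i hi => hg i (Finset.mem_sdiff.mp hi).1) using 1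
  rw [add_comm, Finset.sum_sdiff hP, add_comm, Finset.sum_sdiff hP]
  simp

lemma splitNumer_mem_theta (S : Finset ι) (x : ι → ℂ) (w : ℕ → ℂ) :
    splitNumer φ κ δ S x w ∈ theta φ (S.card * 3) (∑ i ∈ S, 3 * x i) := by
  refine add_mem (theta_sum _ _ fun P hP => theta_const_mul _ ?_)
    (theta_sum _ _ fun P hP => theta_const_mul _ ?_)
  · exact prod_mul_prod_sdiff_mem_theta (Finset.mem_powerset.mp hP)
      (f := fun p z => pairNumer φ (-κ) (-δ) (z - x p)) (g := fun p z => pairDenom φ δ (z - x p))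
      (fun i _ => pairNumer_mem_theta _) fun i _ => pairDenom_mem_theta _
  · exact prod_mul_prod_sdiff_mem_theta (Finset.mem_powerset.mp hP)
      (f := fun p z => pairDenom φ δ (z - x p)) (g := fun p z => pairNumer φ κ δ (z - x p))
      (fun i _ => pairDenom_mem_theta _) fun i _ => pairNumer_mem_theta _

namespace IsBracket
variable (h : IsBracket φ)
include h

lemma pairFactor_neg (u : ℂ) : pairFactor φ κ δ (-u) = pairFactor φ (-κ) (-δ) u := by
  unfold pairFactor
  rw [show -u + κ = -(u + -κ) by ring, show -u + δ - κ = -(u + -δ - -κ) by ring,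
    show -u + δ = -(u + -δ) by ring]
  simp only [h.map_neg, neg_mul_neg]

lemma pairFactor_sub (u v : ℂ) :
    pairFactor φ κ δ (u - v) = pairFactor φ (-κ) (-δ) (v - u) := by
  rw [← h.pairFactor_neg, neg_sub]

lemma splitSum_insert {S : Finset ι} {a : ι} (ha : a ∉ S) (x : ι → ℂ) (w : ℕ → ℂ)
    (hx : IsGeneric φ δ (insert a S) x) :
    splitSum φ κ δ (insert a S) x w * ∏ j ∈ S, pairDenom φ δ (x a - x j) =
      splitNumer φ κ δ S x w (x a) := by
  have hne : ∀ j ∈ S, a ≠ j := fun j hj => by rintro rfl; exact ha hj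
  have ha' : a ∈ insert a S := Finset.mem_insert_self a S
  have hS : ∀ j ∈ S, j ∈ insert a S := fun j hj => Finset.mem_insert_of_mem hj
  unfold splitSum splitNumer
  rw [Finset.sum_powerset_insert ha, add_mul, Finset.sum_mul, Finset.sum_mul]
  congr 1
  · refine Finset.sum_congr rfl fun P hP => ?_
    have hPS := Finset.mem_powerset.mp hP
    have e : ∏ p ∈ P, pairNumer φ (-κ) (-δ) (x a - x p) =
        (∏ p ∈ P, pairFactor φ κ δ (x p - x a)) * ∏ p ∈ P, pairDenom φ δ (x a - x p) := by
      rw [← Finset.prod_mul_distrib]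
      refine Finset.prod_congr rfl fun p hp => ?_
      have hp := hPS hp
      rw [h.pairFactor_sub, ← pairDenom_neg, pairFactor_mul_pairDenom
        (hx.ne_zero ha' (hS p hp) (hne p hp)) (by
          rw [← sub_eq_add_neg]; exact hx.sub_ne_zero ha' (hS p hp) (hne p hp))]
    rw [Finset.insert_sdiff_of_notMem S fun hh => ha (hPS hh),
      crossProd_insert_right (by simp [ha]), e, ← Finset.prod_sdiff hPS]
    ring
  · refine Finset.sum_congr rfl fun P hP => ?_
    have hPS := Finset.mem_powerset.mp hP
    have haP : a ∉ P := fun hh => ha (hPS hh)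
    have e : ∏ q ∈ S \ P, pairNumer φ κ δ (x a - x q) =
        (∏ q ∈ S \ P, pairFactor φ κ δ (x a - x q)) * ∏ q ∈ S \ P, pairDenom φ δ (x a - x q) := by
      rw [← Finset.prod_mul_distrib]
      refine Finset.prod_congr rfl fun p hp => ?_
      have hp := (Finset.mem_sdiff.mp hp).1
      rw [pairFactor_mul_pairDenom (hx.ne_zero ha' (hS p hp) (hne p hp))
        (hx.add_ne_zero ha' (hS p hp) (hne p hp))]
    rw [insert_sdiff_insert_of_notMem ha, crossProd_insert_left haP,
      Finset.card_insert_of_notMem haP, e, ← Finset.prod_sdiff hPS]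
    ring

/-- At `z = x j` the two halves of the numerator cancel. -/
lemma splitNumer_self {T : Finset ι} {j : ι} (hj : j ∉ T) (x : ι → ℂ) (w : ℕ → ℂ)
    (hx : IsGeneric φ δ (insert j T) x) : splitNumer φ κ δ (insert j T) x w (x j) = 0 := by
  have hne : ∀ i ∈ T, j ≠ i := fun i hi => by rintro rfl; exact hj hi
  have hj' : j ∈ insert j T := Finset.mem_insert_self j T
  have hT : ∀ i ∈ T, i ∈ insert j T := fun i hi => Finset.mem_insert_of_mem hi
  have hD : pairDenom φ δ 0 = 0 := by simp [pairDenom, h.map_zero]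
  have hN : pairNumer φ (-κ) (-δ) 0 = -pairNumer φ κ δ 0 := by
    unfold pairNumer
    rw [show (0 : ℂ) + -κ = -(0 + κ) by ring, show (0 : ℂ) + -δ - -κ = -(0 + δ - κ) by ring,
      show (0 : ℂ) - -δ = -(0 - δ) by ring]
    simp only [h.map_neg]
    ring
  unfold splitNumer
  rw [Finset.sum_powerset_insert hj, Finset.sum_powerset_insert hj]
  rw [Finset.sum_eq_zero (s := T.powerset) (f := fun P => w P.card *
      crossProd φ κ δ x P (insert j T \ P) * ((∏ p ∈ P, pairNumer φ (-κ) (-δ) (x j - x p)) *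
        ∏ q ∈ insert j T \ P, pairDenom φ δ (x j - x q))) fun P hP => by
      rw [Finset.prod_eq_zero (s := insert j T \ P) (i := j) (by
        simpa using fun hh => hj (Finset.mem_powerset.mp hP hh)) (by rw [sub_self, hD])]
      ring,
    Finset.sum_eq_zero (s := T.powerset) (f := fun P => w ((insert j P).card + 1) *
      crossProd φ κ δ x (insert j P) (insert j T \ insert j P) *
      ((∏ p ∈ insert j P, pairDenom φ δ (x j - x p)) *
        ∏ q ∈ insert j T \ insert j P, pairNumer φ κ δ (x j - x q))) fun P hP => by
      rw [Finset.prod_eq_zero (s := insert j P) (i := j) (by simp) (by rw [sub_self, hD])]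
      ring, zero_add, add_zero, ← Finset.sum_add_distrib]
  refine Finset.sum_eq_zero fun P hP => ?_
  have hPT := Finset.mem_powerset.mp hP
  have hjP : j ∉ P := fun hh => hj (hPT hh)
  have e1 : ∏ p ∈ P, pairNumer φ (-κ) (-δ) (x j - x p) =
      (∏ p ∈ P, pairFactor φ κ δ (x p - x j)) * ∏ p ∈ P, pairDenom φ δ (x j - x p) := by
    rw [← Finset.prod_mul_distrib]
    refine Finset.prod_congr rfl fun p hp => ?_
    have hp := hPT hp
    rw [h.pairFactor_sub, ← pairDenom_neg, pairFactor_mul_pairDenom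
      (hx.ne_zero hj' (hT p hp) (hne p hp)) (by
        rw [← sub_eq_add_neg]; exact hx.sub_ne_zero hj' (hT p hp) (hne p hp))]
  have e2 : ∏ q ∈ T \ P, pairNumer φ κ δ (x j - x q) =
      (∏ q ∈ T \ P, pairFactor φ κ δ (x j - x q)) * ∏ q ∈ T \ P, pairDenom φ δ (x j - x q) := by
    rw [← Finset.prod_mul_distrib]
    refine Finset.prod_congr rfl fun p hp => ?_
    have hp := (Finset.mem_sdiff.mp hp).1
    rw [pairFactor_mul_pairDenom (hx.ne_zero hj' (hT p hp) (hne p hp))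
      (hx.add_ne_zero hj' (hT p hp) (hne p hp))]
  rw [insert_sdiff_insert_of_notMem hj, Finset.insert_sdiff_of_notMem T hjP,
    crossProd_insert_left hjP, crossProd_insert_right (by simp [hj]),
    Finset.card_insert_of_notMem hjP, Finset.prod_insert hjP,
    Finset.prod_insert (by simp [hj] : j ∉ T \ P), sub_self, hN, e1, e2]
  ring

/-- At `z = x j - δ` the numerator is a multiple of the sum for the variables other than `x j`. -/
lemma splitNumer_sub {T : Finset ι} {j : ι} (hj : j ∉ T) (x : ι → ℂ) (w : ℕ → ℂ)
    (hx : IsGeneric φ δ (insert j T) x) : splitNumer φ κ δ (insert j T) x w (x j - δ) =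
      pairNumer φ κ δ (-δ) * (∏ i ∈ T, pairNumer φ κ δ (x j - δ - x i)) *
        splitSum φ κ δ T x (fun k => w (k + 1)) := by
  have hne : ∀ i ∈ T, j ≠ i := fun i hi => by rintro rfl; exact hj hi
  have hj' : j ∈ insert j T := Finset.mem_insert_self j T
  have hT : ∀ i ∈ T, i ∈ insert j T := fun i hi => Finset.mem_insert_of_mem hi
  have hz : x j - δ - x j = -δ := by ring
  have hD : pairDenom φ δ (-δ) = 0 := by simp [pairDenom, h.map_zero]
  have hN : pairNumer φ (-κ) (-δ) (-δ) = 0 := by simp [pairNumer, h.map_zero]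
  unfold splitNumer splitSum
  rw [Finset.sum_eq_zero (s := (insert j T).powerset) (f := fun P => w P.card *
      crossProd φ κ δ x P (insert j T \ P) * ((∏ p ∈ P, pairNumer φ (-κ) (-δ) (x j - δ - x p)) *
        ∏ q ∈ insert j T \ P, pairDenom φ δ (x j - δ - x q))) fun P hP => by
      by_cases hjP : j ∈ P
      · rw [Finset.prod_eq_zero (s := P) hjP (by rw [hz, hN])]
        ring
      · rw [Finset.prod_eq_zero (s := insert j T \ P) (i := j) (by simpa using hjP)
          (by rw [hz, hD])]
        ring,
    zero_add, Finset.sum_powerset_insert hj,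
    Finset.sum_eq_zero (s := T.powerset) (f := fun P => w ((insert j P).card + 1) *
      crossProd φ κ δ x (insert j P) (insert j T \ insert j P) *
      ((∏ p ∈ insert j P, pairDenom φ δ (x j - δ - x p)) *
        ∏ q ∈ insert j T \ insert j P, pairNumer φ κ δ (x j - δ - x q))) fun P hP => by
      rw [Finset.prod_eq_zero (s := insert j P) (i := j) (by simp) (by rw [hz, hD])]
      ring, add_zero, Finset.mul_sum]
  refine Finset.sum_congr rfl fun P hP => ?_
  have hPT := Finset.mem_powerset.mp hP
  have hjP : j ∉ P := fun hh => hj (hPT hh)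
  have e1 : ∏ p ∈ P, pairNumer φ κ δ (x j - δ - x p) =
      (∏ p ∈ P, pairFactor φ κ δ (x p - x j)) * ∏ p ∈ P, pairDenom φ δ (x j - δ - x p) := by
    rw [← Finset.prod_mul_distrib]
    refine Finset.prod_congr rfl fun p hp => ?_
    have hp := hPT hp
    rw [h.pairFactor_sub]
    have h1 := hx.ne_zero hj' (hT p hp) (hne p hp)
    have h2 := hx.sub_ne_zero hj' (hT p hp) (hne p hp)
    generalize x j = u at *
    generalize x p = v at *
    unfold pairFactor pairDenom pairNumer
    rw [show u - v + -κ = u - v - κ by ring, show u - v + -δ - -κ = u - δ - v + κ by ring,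
      show u - v + -δ = u - v - δ by ring, show u - δ - v + δ - κ = u - v - κ by ring,
      show u - δ - v + δ = u - v by ring, show u - δ - v = u - v - δ by ring]
    field_simp
  rw [Finset.insert_sdiff_of_notMem T hjP, crossProd_insert_right (by simp [hj]),
    Finset.prod_insert (by simp [hj] : j ∉ T \ P), hz, ← Finset.prod_sdiff hPT, e1]
  ring

/-- At `z = x j + δ` the numerator is a multiple of the sum for the variables other than `x j`. -/
lemma splitNumer_add {T : Finset ι} {j : ι} (hj : j ∉ T) (x : ι → ℂ) (w : ℕ → ℂ)
    (hx : IsGeneric φ δ (insert j T) x) : splitNumer φ κ δ (insert j T) x w (x j + δ) =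
      pairNumer φ (-κ) (-δ) δ * (∏ i ∈ T, pairNumer φ (-κ) (-δ) (x j + δ - x i)) *
        splitSum φ κ δ T x (fun k => w (k + 1)) := by
  have hne : ∀ i ∈ T, j ≠ i := fun i hi => by rintro rfl; exact hj hi
  have hj' : j ∈ insert j T := Finset.mem_insert_self j T
  have hT : ∀ i ∈ T, i ∈ insert j T := fun i hi => Finset.mem_insert_of_mem hi
  have hz : x j + δ - x j = δ := by ring
  have hD : pairDenom φ δ δ = 0 := by simp [pairDenom, h.map_zero]
  have hN : pairNumer φ κ δ δ = 0 := by simp [pairNumer, h.map_zero]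
  unfold splitNumer splitSum
  rw [Finset.sum_eq_zero (s := (insert j T).powerset) (f := fun P => w (P.card + 1) *
      crossProd φ κ δ x P (insert j T \ P) * ((∏ p ∈ P, pairDenom φ δ (x j + δ - x p)) *
        ∏ q ∈ insert j T \ P, pairNumer φ κ δ (x j + δ - x q))) fun P hP => by
      by_cases hjP : j ∈ P
      · rw [Finset.prod_eq_zero (s := P) hjP (by rw [hz, hD])]
        ring
      · rw [Finset.prod_eq_zero (s := insert j T \ P) (i := j) (by simpa using hjP)
          (by rw [hz, hN])]
        ring,
    add_zero, Finset.sum_powerset_insert hj,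
    Finset.sum_eq_zero (s := T.powerset) (f := fun P => w P.card *
      crossProd φ κ δ x P (insert j T \ P) *
      ((∏ p ∈ P, pairNumer φ (-κ) (-δ) (x j + δ - x p)) *
        ∏ q ∈ insert j T \ P, pairDenom φ δ (x j + δ - x q))) fun P hP => by
      rw [Finset.prod_eq_zero (s := insert j T \ P) (i := j) (by
        simpa using fun hh => hj (Finset.mem_powerset.mp hP hh)) (by rw [hz, hD])]
      ring, zero_add, Finset.mul_sum]
  refine Finset.sum_congr rfl fun P hP => ?_
  have hPT := Finset.mem_powerset.mp hP
  have hjP : j ∉ P := fun hh => hj (hPT hh)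
  have e1 : ∏ q ∈ T \ P, pairNumer φ (-κ) (-δ) (x j + δ - x q) =
      (∏ q ∈ T \ P, pairFactor φ κ δ (x j - x q)) * ∏ q ∈ T \ P, pairDenom φ δ (x j + δ - x q) := by
    rw [← Finset.prod_mul_distrib]
    refine Finset.prod_congr rfl fun p hp => ?_
    have hp := (Finset.mem_sdiff.mp hp).1
    have h1 := hx.ne_zero hj' (hT p hp) (hne p hp)
    have h2 := hx.add_ne_zero hj' (hT p hp) (hne p hp)
    generalize x j = u at *
    generalize x p = v at *
    unfold pairFactor pairDenom pairNumer
    rw [show u + δ - v + -κ = u - v + δ - κ by ring,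
      show u + δ - v + -δ - -κ = u - v + κ by ring, show u + δ - v - -δ = u + δ - v + δ by ring,
      show u + δ - v - δ = u - v by ring, show u + δ - v = u - v + δ by ring]
    field_simp
  rw [insert_sdiff_insert_of_notMem hj, crossProd_insert_left hjP,
    Finset.card_insert_of_notMem hjP, Finset.prod_insert hjP, hz, ← Finset.prod_sdiff hPT, e1]
  ring

omit [DecidableEq ι] in
lemma crossProd_neg {x x' : ι → ℂ} {A B : Finset ι} (hA : ∀ a ∈ A, x' a = -x a)
    (hB : ∀ a ∈ B, x' a = -x a) : crossProd φ κ δ x' A B = crossProd φ (-κ) (-δ) x A B :=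
  Finset.prod_congr rfl fun a ha => Finset.prod_congr rfl fun b hb => by
    rw [hA a ha, hB b hb, ← h.pairFactor_neg]
    congr 1
    ring

lemma splitSum_neg {x x' : ι → ℂ} {S : Finset ι} (hS : ∀ a ∈ S, x' a = -x a) (w : ℕ → ℂ) :
    splitSum φ κ δ S x' w = splitSum φ (-κ) (-δ) S x w :=
  Finset.sum_congr rfl fun P hP => by
    rw [h.crossProd_neg (fun a ha => hS a (Finset.mem_powerset.mp hP ha))
      fun a ha => hS a (Finset.mem_sdiff.mp ha).1]

end IsBracket

end Splitting

/-! ### The splitting identity: induction on the number of variables -/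

namespace IsBracket
variable {ι : Type*} [DecidableEq ι] {φ : ℂ → ℂ} {κ δ : ℂ} (h : IsBracket φ)
include h

/-- The difference of the two sides of the splitting identity does not depend on `x a`, provided
that the identity holds for fewer variables. -/
lemma splitSum_sub_update (h1 : φ δ ≠ 0) (h2 : φ (2 * δ) ≠ 0) {S : Finset ι} {a : ι} (ha : a ∉ S)
    (x : ι → ℂ) (z : ℂ) (w : ℕ → ℂ) (hx : IsGeneric φ δ (insert a S) x)
    (hz : IsGeneric φ δ (insert a S) (Function.update x a z))
    (IH : ∀ j ∈ S, splitSum φ κ δ (S.erase j) x (fun k => w (k + 1)) =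
      splitSum φ (-κ) (-δ) (S.erase j) x (fun k => w (k + 1))) :
    splitSum φ κ δ (insert a S) x w - splitSum φ (-κ) (-δ) (insert a S) x w =
      splitSum φ κ δ (insert a S) (Function.update x a z) w -
        splitSum φ (-κ) (-δ) (insert a S) (Function.update x a z) w := by
  rcases S.eq_empty_or_nonempty with rfl | hS
  · simp only [splitSum, Finset.sum_powerset_insert ha]
    simp [crossProd]
  have hS' : ∀ j ∈ S, j ∈ insert a S := fun j hj => Finset.mem_insert_of_mem hj
  have ha' : a ∈ insert a S := Finset.mem_insert_self a S
  have hne : ∀ j ∈ S, a ≠ j := fun j hj => by rintro rfl; exact ha hj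
  have hxS := hx.mono (Finset.subset_insert a S)
  have hu : ∀ j ∈ S, Function.update x a z j = x j := fun j hj =>
    Function.update_of_ne (hne j hj).symm _ _
  have hδ : ∀ k ∈ Finset.Icc (-2 : ℤ) 2, k ≠ 0 → φ (k * δ) ≠ 0 := by
    intro k hk hk0
    rw [Finset.mem_Icc] at hk
    obtain rfl | rfl | rfl | rfl : k = -2 ∨ k = -1 ∨ k = 1 ∨ k = 2 := by omega
    · simpa [h.map_neg] using h2
    · simpa [h.map_neg] using h1
    · simpa using h1
    · simpa using h2
  -- the nodes are `x j`, `x j - δ` and `x j + δ` for `j ∈ S`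
  let K : Finset ℤ := {-1, 0, 1}
  let J : Finset (ι × ℤ) := S ×ˢ K
  let c : ι × ℤ → ℂ := fun p => x p.1 + p.2 * δ
  have hK : K.card = 3 := rfl
  have hJ : J.card = S.card * 3 := by simp only [J, Finset.card_product, hK]
  have hc : ∀ p ∈ J, ∀ q ∈ J, p ≠ q → φ (c p - c q) ≠ 0 := by
    rintro ⟨i, k⟩ hp ⟨j, l⟩ hq hpq
    simp only [J, K, Finset.mem_product, Finset.mem_insert, Finset.mem_singleton] at hp hq
    have hkl : k - l ∈ Finset.Icc (-2 : ℤ) 2 := by rw [Finset.mem_Icc]; omega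
    have e : c (i, k) - c (j, l) = x i - x j + ((k - l : ℤ) : ℂ) * δ := by
      simp only [c]
      push_cast
      ring
    rw [e]
    by_cases hij : i = j
    · subst hij
      rw [sub_self, zero_add]
      exact hδ _ hkl fun h0 => hpq (by rw [sub_eq_zero.mp h0])
    · exact hxS i hp.1 j hq.1 hij _ hkl
  have hprod : ∀ u, ∏ p ∈ J, φ (u - c p) = ∏ j ∈ S, pairDenom φ δ (u - x j) := by
    intro u
    simp only [J, c, Finset.prod_product]
    refine Finset.prod_congr rfl fun j _ => ?_
    simp only [K]
    rw [Finset.prod_insert (by decide), Finset.prod_insert (by decide), Finset.prod_singleton,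
      pairDenom]
    push_cast
    rw [show u - (x j + -1 * δ) = u - x j + δ by ring, show u - (x j + 0 * δ) = u - x j by ring,
      show u - (x j + 1 * δ) = u - x j - δ by ring]
    ring
  have hsum : ∑ p ∈ J, c p = ∑ i ∈ S, 3 * x i := by
    simp only [J, c, Finset.sum_product]
    refine Finset.sum_congr rfl fun j _ => ?_
    simp only [K]
    rw [Finset.sum_insert (by decide), Finset.sum_insert (by decide), Finset.sum_singleton]
    push_cast
    ring
  set N := splitNumer φ κ δ S x w with hN
  set N' := splitNumer φ (-κ) (-δ) S x w with hN'
  have hmem : N - N' ∈ theta φ J.card (∑ p ∈ J, c p) := by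
    rw [hJ, hsum]
    exact sub_mem (splitNumer_mem_theta S x w) (splitNumer_mem_theta S x w)
  have h0 : ∀ p ∈ J, (N - N') (c p) = 0 := by
    rintro ⟨j, k⟩ hp
    simp only [J, K, Finset.mem_product, Finset.mem_insert, Finset.mem_singleton] at hp
    obtain ⟨hj, hk⟩ := hp
    have e := Finset.insert_erase hj
    have hxj : IsGeneric φ δ (insert j (S.erase j)) x := by rwa [e]
    have hj' := Finset.notMem_erase j S
    rw [Pi.sub_apply, sub_eq_zero, hN, hN', ← e]
    rcases hk with rfl | rfl | rfl
    · have e1 : c (j, -1) = x j - δ := by simp [c, sub_eq_add_neg]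
      have e2 := h.splitNumer_add (κ := -κ) hj' x w hxj.neg
      rw [← sub_eq_add_neg, neg_neg, neg_neg] at e2
      rw [e1, h.splitNumer_sub hj' x w hxj, e2, IH j hj]
    · have e1 : c (j, 0) = x j := by simp [c]
      rw [e1, h.splitNumer_self hj' x w hxj, h.splitNumer_self hj' x w hxj.neg]
    · have e1 : c (j, 1) = x j + δ := by simp [c]
      have e2 := h.splitNumer_sub (κ := -κ) hj' x w hxj.neg
      rw [sub_neg_eq_add, neg_neg δ] at e2
      rw [e1, h.splitNumer_add hj' x w hxj, e2, IH j hj]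
  have hd : ∀ y, IsGeneric φ δ (insert a S) y → (∀ j ∈ S, y j = x j) →
      ∀ j ∈ S, pairDenom φ δ (y a - x j) ≠ 0 := fun y hy hyx j hj => by
    have g0 := hy.ne_zero ha' (hS' j hj) (hne j hj)
    have g1 := hy.add_ne_zero ha' (hS' j hj) (hne j hj)
    have g2 := hy.sub_ne_zero ha' (hS' j hj) (hne j hj)
    rw [hyx j hj] at g0 g1 g2
    exact mul_ne_zero (mul_ne_zero g0 g1) g2
  have hdx := Finset.prod_ne_zero_iff.mpr (hd x hx fun _ _ => rfl)
  have hdz := Finset.prod_ne_zero_iff.mpr (hd _ hz hu)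
  rw [Function.update_self] at hdz
  have hw : ∀ p ∈ J, φ (z - c p) ≠ 0 := by
    rw [← Finset.prod_ne_zero_iff, hprod]
    exact hdz
  have key := h.theta_eq_const_mul (hS.product ⟨0, by simp [K]⟩) c hmem hc h0 (x a) z hw
  rw [hprod, hprod, Pi.sub_apply, Pi.sub_apply] at key
  -- express the four values of the numerators by `splitSum`
  have hNupd : ∀ κ' δ' : ℂ, splitNumer φ κ' δ' S (Function.update x a z) w z =
      splitNumer φ κ' δ' S x w z := fun κ' δ' => by
    unfold splitNumer
    have hc' : ∀ P ∈ S.powerset, crossProd φ κ' δ' (Function.update x a z) P (S \ P) =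
        crossProd φ κ' δ' x P (S \ P) := fun P hP =>
      Finset.prod_congr rfl fun i hi => Finset.prod_congr rfl fun j hj => by
        rw [hu i (Finset.mem_powerset.mp hP hi), hu j (Finset.mem_sdiff.mp hj).1]
    have hp : ∀ P ∈ S.powerset, ∀ F : ℂ → ℂ, ∏ p ∈ P, F (z - Function.update x a z p) =
        ∏ p ∈ P, F (z - x p) := fun P hP F =>
      Finset.prod_congr rfl fun i hi => by rw [hu i (Finset.mem_powerset.mp hP hi)]
    congr 1 <;>
    · refine Finset.sum_congr rfl fun P hP => ?_
      have hP' : S \ P ∈ S.powerset := Finset.mem_powerset.mpr Finset.sdiff_subset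
      rw [hc' P hP, hp P hP, hp _ hP']
  have v1 := h.splitSum_insert (κ := κ) ha x w hx
  have v2 := h.splitSum_insert (κ := -κ) ha x w hx.neg
  have v3 := h.splitSum_insert (κ := κ) ha _ w hz
  have v4 := h.splitSum_insert (κ := -κ) ha _ w hz.neg
  rw [Function.update_self, hNupd, Finset.prod_congr rfl fun j hj => by rw [hu j hj]] at v3 v4
  simp only [pairDenom_neg] at v2 v4
  rw [hN, hN', ← v1, ← v2, ← v3, ← v4] at key
  refine mul_right_cancel₀ (mul_ne_zero hdx hdz) ?_
  linear_combination key

/-- The splitting identity, which expresses that the operators `D_r` commute. -/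
theorem splitSum_eq (h1 : φ δ ≠ 0) (h2 : φ (2 * δ) ≠ 0) (S : Finset ι) (x : ι → ℂ) (w : ℕ → ℂ)
    (hx : IsGeneric φ δ S x) : splitSum φ κ δ S x w = splitSum φ (-κ) (-δ) S x w := by
  induction S using Finset.strongInduction generalizing x w with
  | H S IH =>
    -- the difference is invariant under translations, so that `x` may be assumed generic
    wlog hx' : ∀ i ∈ S, ∀ j ∈ S, ∀ k ∈ Finset.Icc (-2 : ℤ) 2, φ (x i + x j + k * δ) ≠ 0
      generalizing x
    · obtain ⟨c, hc⟩ := h.exists_generic (S ×ˢ S ×ˢ Finset.Icc (-2 : ℤ) 2) (fun _ => 2)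
        (fun p => x p.1 + x p.2.1 + p.2.2 * δ) (by simp)
      have := this (fun i => x i + c)
        (fun i hi j hj hij k hk => by
          simpa only [add_sub_add_right_eq_sub] using hx i hi j hj hij k hk)
        (fun i hi j hj k hk => by
          convert hc (i, j, k) (by simp [hi, hj]; simpa using hk) using 2
          ring)
      simpa only [splitSum, crossProd, add_sub_add_right_eq_sub] using this
    -- change the signs of the variables one by one
    let X : Finset ι → ι → ℂ := fun T i => if i ∈ T then -x i else x i
    have hX : ∀ T, IsGeneric φ δ S (X T) := by
      intro T i hi j hj hij k hk
      have hk' : -k ∈ Finset.Icc (-2 : ℤ) 2 := by simp only [Finset.mem_Icc] at hk ⊢; omega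
      by_cases hiT : i ∈ T <;> by_cases hjT : j ∈ T <;> simp only [X, hiT, hjT, if_true, if_false]
      · rw [show -x i - -x j + k * δ = x j - x i + k * δ by ring]
        exact hx j hj i hi hij.symm k hk
      · rw [show -x i - x j + k * δ = -(x i + x j + (-k : ℤ) * δ) by push_cast; ring, h.map_neg]
        exact neg_ne_zero.mpr (hx' i hi j hj _ hk')
      · rw [sub_neg_eq_add]
        exact hx' i hi j hj k hk
      · exact hx i hi j hj hij k hk
    have key : ∀ T ⊆ S, splitSum φ κ δ S (X T) w - splitSum φ (-κ) (-δ) S (X T) w =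
        splitSum φ κ δ S x w - splitSum φ (-κ) (-δ) S x w := by
      intro T hT
      induction T using Finset.induction_on with
      | empty => simp [X]
      | insert a T ha ih =>
        have haS := hT (Finset.mem_insert_self a T)
        rw [← ih ((Finset.subset_insert a T).trans hT)]
        have e : X (insert a T) = Function.update (X T) a (-x a) := by
          ext i
          by_cases hia : i = a
          · subst hia
            simp [X]
          · simp [X, hia]
        have g1 := hX T
        have g2 := hX (insert a T)
        rw [e] at g2 ⊢
        have e2 := Finset.insert_erase haS
        rw [← e2] at g1 g2
        have := h.splitSum_sub_update h1 h2 (Finset.notMem_erase a S) (X T) (-x a) w g1 g2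
          (fun j hj => IH _ ((Finset.erase_subset _ _).trans_ssubset (Finset.erase_ssubset haS)) _ _
            ((hX T).mono ((Finset.erase_subset _ _).trans (Finset.erase_subset _ _))))
        rw [e2] at this
        exact this.symm
    have h3 := key S subset_rfl
    have hXS : ∀ a ∈ S, X S a = -x a := fun a ha => by simp [X, ha]
    have e1 := h.splitSum_neg (κ := κ) (δ := δ) hXS w
    have e2 := h.splitSum_neg (κ := -κ) (δ := -δ) hXS w
    rw [neg_neg, neg_neg] at e2
    rw [e1, e2] at h3
    linear_combination -h3 / 2

end IsBracket

/-! ### Meromorphic functions and their values at generic points -/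

lemma algebraMap_mero_ne_zero {n : ℕ} {e : Entire n} (he : e ≠ 0) :
    algebraMap (Entire n) (Mero n) e ≠ 0 :=
  (map_ne_zero_iff _ (IsFractionRing.injective (Entire n) (Mero n))).mpr he

/-- The meromorphic function `f` is given by `g` at all points where some nonzero entire function
does not vanish. This is compatible with the field operations, so that identities between
fractions may be checked at generic points. -/
def Represents {n : ℕ} (f : Mero n) (g : (Fin n → ℂ) → ℂ) : Prop :=
  ∃ a b : Entire n, b ≠ 0 ∧
    f * algebraMap (Entire n) (Mero n) b = algebraMap (Entire n) (Mero n) a ∧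
    ∀ x, b.1 x ≠ 0 → g x * b.1 x = a.1 x

namespace Represents
variable {n : ℕ} {f f' : Mero n} {g g' : (Fin n → ℂ) → ℂ}

lemma of_entire (e : Entire n) : Represents (algebraMap (Entire n) (Mero n) e) e.1 :=
  ⟨e, 1, one_ne_zero, by simp, fun x _ => mul_one _⟩

lemma add (hf : Represents f g) (hf' : Represents f' g') :
    Represents (f + f') (fun x => g x + g' x) := by
  obtain ⟨a, b, hb, h1, h2⟩ := hf
  obtain ⟨a', b', hb', h1', h2'⟩ := hf'
  refine ⟨a * b' + a' * b, b * b', mul_ne_zero hb hb', ?_, fun x hx => ?_⟩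
  · simp only [map_add, map_mul, ← h1, ← h1']
    ring
  · change b.1 x * b'.1 x ≠ 0 at hx
    change (g x + g' x) * (b.1 x * b'.1 x) = a.1 x * b'.1 x + a'.1 x * b.1 x
    rw [← h2 x (left_ne_zero_of_mul hx), ← h2' x (right_ne_zero_of_mul hx)]
    ring

lemma mul (hf : Represents f g) (hf' : Represents f' g') :
    Represents (f * f') (fun x => g x * g' x) := by
  obtain ⟨a, b, hb, h1, h2⟩ := hf
  obtain ⟨a', b', hb', h1', h2'⟩ := hf'
  refine ⟨a * a', b * b', mul_ne_zero hb hb', ?_, fun x hx => ?_⟩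
  · simp only [map_mul, ← h1, ← h1']
    ring
  · change b.1 x * b'.1 x ≠ 0 at hx
    change (g x * g' x) * (b.1 x * b'.1 x) = a.1 x * a'.1 x
    rw [← h2 x (left_ne_zero_of_mul hx), ← h2' x (right_ne_zero_of_mul hx)]
    ring

lemma div (hf : Represents f g) (hf' : Represents f' g') (h0 : f' ≠ 0) :
    Represents (f / f') (fun x => g x / g' x) := by
  obtain ⟨a, b, hb, h1, h2⟩ := hf
  obtain ⟨a', b', hb', h1', h2'⟩ := hf'
  have ha' : a' ≠ 0 := by
    rintro rfl
    rw [map_zero] at h1'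
    exact mul_ne_zero h0 (algebraMap_mero_ne_zero hb') h1'
  refine ⟨a * b' * b', b * a' * b', mul_ne_zero (mul_ne_zero hb ha') hb', ?_, fun x hx => ?_⟩
  · simp only [map_mul, ← h1, ← h1']
    field_simp
  · change b.1 x * a'.1 x * b'.1 x ≠ 0 at hx
    change g x / g' x * (b.1 x * a'.1 x * b'.1 x) = a.1 x * b'.1 x * b'.1 x
    have hx' := left_ne_zero_of_mul hx
    have e := h2' x (right_ne_zero_of_mul hx)
    have hg : g' x ≠ 0 := by
      intro h
      rw [h, zero_mul] at e
      exact right_ne_zero_of_mul hx' e.symm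
    rw [← h2 x (left_ne_zero_of_mul hx'), ← e]
    field_simp

lemma smul (c : ℂ) (hf : Represents f g) : Represents (c • f) (fun x => c * g x) := by
  rw [Algebra.smul_def, IsScalarTower.algebraMap_apply ℂ (Entire n) (Mero n)]
  exact (of_entire (algebraMap ℂ (Entire n) c)).mul hf

lemma sum {ι : Type*} (s : Finset ι) {f : ι → Mero n} {g : ι → (Fin n → ℂ) → ℂ}
    (hf : ∀ i ∈ s, Represents (f i) (g i)) :
    Represents (∑ i ∈ s, f i) (fun x => ∑ i ∈ s, g i x) := by
  classical
  induction s using Finset.induction_on with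
  | empty =>
    simp only [Finset.sum_empty]
    have := of_entire (0 : Entire n)
    rwa [map_zero] at this
  | insert i s hi ih =>
    simp only [Finset.sum_insert hi]
    exact (hf i (by simp)).add (ih fun j hj => hf j (by simp [hj]))

lemma prod {ι : Type*} (s : Finset ι) {f : ι → Mero n} {g : ι → (Fin n → ℂ) → ℂ}
    (hf : ∀ i ∈ s, Represents (f i) (g i)) :
    Represents (∏ i ∈ s, f i) (fun x => ∏ i ∈ s, g i x) := by
  classical
  induction s using Finset.induction_on with
  | empty =>
    simp only [Finset.prod_empty]
    have := of_entire (1 : Entire n)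
    rwa [map_one] at this
  | insert i s hi ih =>
    simp only [Finset.prod_insert hi]
    exact (hf i (by simp)).mul (ih fun j hj => hf j (by simp [hj]))

lemma eq_zero (hf : Represents f g) (e : Entire n) (he : e ≠ 0)
    (hg : ∀ x, e.1 x ≠ 0 → g x = 0) : f = 0 := by
  obtain ⟨a, b, hb, h1, h2⟩ := hf
  have ha : a * (b * e) = 0 := by
    refine Subtype.ext (funext fun x => ?_)
    change a.1 x * (b.1 x * e.1 x) = 0
    by_cases hbx : b.1 x = 0
    · simp [hbx]
    by_cases hex : e.1 x = 0
    · simp [hex]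
    rw [← h2 x hbx, hg x hex]
    ring
  rw [(mul_eq_zero.mp ha).resolve_right (mul_ne_zero hb he), map_zero] at h1
  exact (mul_eq_zero.mp h1).resolve_right (algebraMap_mero_ne_zero hb)

lemma eq_of_generic (hf : Represents f g) (hf' : Represents f' g') (e : Entire n) (he : e ≠ 0)
    (hg : ∀ x, e.1 x ≠ 0 → g x = g' x) : f = f' := by
  have := (hf.add (hf'.smul (-1))).eq_zero e he fun x hx => by rw [hg x hx]; ring
  rw [neg_one_smul] at this
  exact eq_of_sub_eq_zero (by rwa [sub_eq_add_neg])

end Represents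

/-- The entire function `x ↦ [x_i - x_j + c]`. -/
def brkEntire {φ : ℂ → ℂ} (hφ : Differentiable ℂ φ) {n : ℕ} (i j : Fin n) (c : ℂ) : Entire n :=
  ⟨fun x => φ (x i - x j + c), fun x _ =>
    AnalyticAt.comp (g := φ) (f := fun y : Fin n → ℂ => y i - y j + c)
      (hφ.analyticAt _)
      ((((ContinuousLinearMap.proj (R := ℂ) (φ := fun _ : Fin n => ℂ) i).analyticAt x).sub
        ((ContinuousLinearMap.proj (R := ℂ) (φ := fun _ : Fin n => ℂ) j).analyticAt x)).add
        analyticAt_const)⟩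

section Brackets
variable {φ : ℂ → ℂ} (hφ : Differentiable ℂ φ) {n : ℕ}

lemma brk_eq_algebraMap (i j : Fin n) (c : ℂ) :
    brk hφ i j c = algebraMap (Entire n) (Mero n) (brkEntire hφ i j c) := rfl

lemma represents_brk (i j : Fin n) (c : ℂ) :
    Represents (brk hφ i j c) (fun x => φ (x i - x j + c)) :=
  Represents.of_entire (brkEntire hφ i j c)

lemma brkEntire_ne_zero (h : IsBracket φ) {i j : Fin n} (hij : i ≠ j) (c : ℂ) :
    brkEntire hφ i j c ≠ 0 := by
  obtain ⟨z, hz⟩ := Function.ne_iff.mp h.ne_zero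
  intro h0
  have := congrFun (congrArg Subtype.val h0) (Pi.single i (z - c))
  refine hz ?_
  simpa [brkEntire, hij.symm] using this

lemma brk_ne_zero (h : IsBracket φ) {i j : Fin n} (hij : i ≠ j) (c : ℂ) : brk hφ i j c ≠ 0 :=
  algebraMap_mero_ne_zero (brkEntire_ne_zero hφ h hij c)

lemma brk_self (i : Fin n) (c : ℂ) : brk hφ i i c = algebraMap ℂ (Mero n) (φ c) := by
  rw [IsScalarTower.algebraMap_apply ℂ (Entire n) (Mero n), brk_eq_algebraMap]
  congr 1
  refine Subtype.ext (funext fun x => ?_)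
  change φ (x i - x i + c) = φ c
  rw [sub_self, zero_add]

lemma brk_swap (h : IsBracket φ) (i j : Fin n) (c : ℂ) : brk hφ j i (-c) = -brk hφ i j c := by
  rw [brk_eq_algebraMap, brk_eq_algebraMap, ← map_neg]
  congr 1
  refine Subtype.ext (funext fun x => ?_)
  change φ (x j - x i + -c) = -φ (x i - x j + c)
  rw [← h.map_neg]
  congr 1
  ring

lemma meroShift_brk (c : Fin n → ℂ) (i j : Fin n) (u : ℂ) :
    meroShift c (brk hφ i j u) = brk hφ i j (u + (c i - c j)) := by
  rw [brk_eq_algebraMap, brk_eq_algebraMap, meroShift]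
  rw [IsLocalization.algEquivOfAlgEquiv_eq]
  congr 1
  refine Subtype.ext (funext fun x => ?_)
  change φ ((x + c) i - (x + c) j + u) = φ (x i - x j + (u + (c i - c j)))
  rw [Pi.add_apply, Pi.add_apply]
  congr 1
  ring

/-- The meromorphic function `pairFactor φ κ δ (x_i - x_j)`. -/
noncomputable def pairFun (κ δ : ℂ) (i j : Fin n) : Mero n :=
  brk hφ i j κ * brk hφ i j (δ - κ) / (brk hφ i j 0 * brk hφ i j δ)

/-- The splitting identity for meromorphic functions. -/
theorem sum_prod_pairFun (h : IsBracket φ) {κ δ : ℂ} (h1 : φ δ ≠ 0) (h2 : φ (2 * δ) ≠ 0)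
    (S : Finset (Fin n)) (w : ℕ → ℂ) :
    ∑ P ∈ S.powerset, w P.card • ∏ p ∈ P, ∏ q ∈ S \ P, pairFun hφ κ δ p q =
      ∑ P ∈ S.powerset, w P.card • ∏ p ∈ P, ∏ q ∈ S \ P, pairFun hφ κ δ q p := by
  have hr : ∀ i j : Fin n, i ≠ j →
      Represents (pairFun hφ κ δ i j) (fun x => pairFactor φ κ δ (x i - x j)) := fun i j hij => by
    have := (((represents_brk hφ i j κ).mul (represents_brk hφ i j (δ - κ))).div
      ((represents_brk hφ i j 0).mul (represents_brk hφ i j δ))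
      (mul_ne_zero (brk_ne_zero hφ h hij 0) (brk_ne_zero hφ h hij δ)))
    simpa only [pairFun, pairFactor, add_zero, add_sub_assoc] using this
  have hne : ∀ P : Finset (Fin n), ∀ p ∈ P, ∀ q ∈ S \ P, p ≠ q := by
    rintro P p hp q hq rfl
    exact (Finset.mem_sdiff.mp hq).2 hp
  refine Represents.eq_of_generic
    (Represents.sum _ fun P _ => (Represents.prod _ fun p hp => Represents.prod _ fun q hq =>
      hr p q (hne P p hp q hq)).smul _)
    (Represents.sum _ fun P _ => (Represents.prod _ fun p hp => Represents.prod _ fun q hq =>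
      hr q p (hne P p hp q hq).symm).smul _)
    (∏ i ∈ S, ∏ j ∈ S.erase i, ∏ k ∈ Finset.Icc (-2 : ℤ) 2, brkEntire hφ i j (k * δ)) ?_ ?_
  · simp only [Finset.prod_ne_zero_iff]
    exact fun i _ j hj k _ => brkEntire_ne_zero hφ h (Finset.ne_of_mem_erase hj).symm _
  · intro x hx
    have hgen : IsGeneric φ δ S x := by
      intro i hi j hj hij k hk h0
      refine hx ?_
      rw [← Finset.mul_prod_erase S _ hi,
        ← Finset.mul_prod_erase (S.erase i) _ (Finset.mem_erase.mpr ⟨hij.symm, hj⟩),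
        ← Finset.mul_prod_erase _ _ hk]
      change (φ (x i - x j + k * δ) * _) * _ * _ = 0
      rw [h0, zero_mul, zero_mul, zero_mul]
    refine (h.splitSum_eq (κ := κ) h1 h2 S x w hgen).trans ?_
    refine Finset.sum_congr rfl fun P _ => ?_
    congr 1
    exact Finset.prod_congr rfl fun p _ => Finset.prod_congr rfl fun q _ =>
      (h.pairFactor_sub _ _).symm

/-- The Wronski identity for meromorphic functions, with `y_k = -x_k - ν_k δ`. -/
theorem sum_wronski (h : IsBracket φ) (S : Finset (Fin n)) (c : Fin n → ℂ) (t : ℂ) :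
    ∑ I ∈ S.powerset, ((-1) ^ I.card * φ (I.card * t - ∑ k ∈ S, c k)) •
      ((∏ i ∈ I, ∏ j ∈ S \ I, brk hφ i j t / brk hφ i j 0) *
        (∏ i ∈ I, ∏ k ∈ S, brk hφ i k (-c k)) *
        ∏ i ∈ S \ I, ∏ k ∈ S, brk hφ i k (t - c k)) = 0 := by
  refine Represents.eq_zero (Represents.sum _ fun I _ => (((Represents.prod _ fun i hi =>
      Represents.prod _ fun j hj => (represents_brk hφ i j t).div (represents_brk hφ i j 0)
        (brk_ne_zero hφ h (by rintro rfl; exact (Finset.mem_sdiff.mp hj).2 hi) 0)).mul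
      (Represents.prod _ fun i _ => Represents.prod _ fun k _ => represents_brk hφ i k _)).mul
      (Represents.prod _ fun i _ => Represents.prod _ fun k _ => represents_brk hφ i k _)).smul _)
    (∏ i ∈ S, ∏ j ∈ S.erase i, brkEntire hφ i j 0) ?_ ?_
  · simp only [Finset.prod_ne_zero_iff]
    exact fun i _ j hj => brkEntire_ne_zero hφ h (Finset.ne_of_mem_erase hj).symm _
  · intro x hx
    refine Eq.trans ?_ (h.wronskiSum_eq_zero (S := S) (R := S) rfl x (fun k => -x k - c k) t
      fun i hi j hj hij h0 => hx (by
        rw [← Finset.mul_prod_erase S _ hi,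
          ← Finset.mul_prod_erase (S.erase i) _ (Finset.mem_erase.mpr ⟨hij.symm, hj⟩)]
        change (φ (x i - x j + 0) * _) * _ = 0
        rw [add_zero, h0, zero_mul, zero_mul]))
    unfold wronskiSum
    refine Finset.sum_congr rfl fun I _ => ?_
    rw [show ∑ i ∈ S, x i + ∑ k ∈ S, (-x k - c k) + I.card * t = I.card * t - ∑ k ∈ S, c k by
      rw [Finset.sum_sub_distrib, Finset.sum_neg_distrib]; ring]
    have e1 : ∀ i k, φ (x i - x k + -c k) = φ (x i + (-x k - c k)) := fun i k => by
      congr 1; ring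
    have e2 : ∀ i k, φ (x i - x k + (t - c k)) = φ (x i + (-x k - c k) + t) := fun i k => by
      congr 1; ring
    simp only [add_zero, e1, e2]
    ring

end Brackets

/-! ### Commutativity of the operators `D_r` -/

lemma meroShift_algebraMap {n : ℕ} (c : Fin n → ℂ) (e : Entire n) :
    meroShift c (algebraMap (Entire n) (Mero n) e) =
      algebraMap (Entire n) (Mero n) (entireShift c e) := by
  rw [meroShift, IsLocalization.algEquivOfAlgEquiv_eq]

lemma meroShift_meroShift {n : ℕ} (c d : Fin n → ℂ) (f : Mero n) :
    meroShift c (meroShift d f) = meroShift (c + d) f := by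
  have key : ∀ e : Entire n, entireShift c (entireShift d e) = entireShift (c + d) e := fun e => by
    refine Subtype.ext (funext fun x => ?_)
    change e.1 (x + c + d) = e.1 (x + (c + d))
    rw [add_assoc]
  obtain ⟨a, b, _, rfl⟩ := IsFractionRing.div_surjective (A := Entire n) f
  simp only [map_div₀, meroShift_algebraMap, key]

/-- The operator `a · T_x^v`, as a linear function of the coefficient `a`. -/
noncomputable def shiftOp {n : ℕ} (v : Fin n → ℂ) : Mero n →ₗ[ℂ] Op n :=
  (LinearMap.mulRight ℂ (T v : Op n)).comp (LinearMap.mul ℂ (Mero n))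

lemma shiftOp_mul {n : ℕ} (v v' : Fin n → ℂ) (a b : Mero n) :
    shiftOp v a * shiftOp v' b = shiftOp (v + v') (a * meroShift v b) := by
  refine LinearMap.ext fun f => ?_
  change a * meroShift v (b * meroShift v' f) = a * meroShift v b * meroShift (v + v') f
  rw [map_mul, meroShift_meroShift, mul_assoc]

section Commutativity
variable {φ : ℂ → ℂ} (hφ : Differentiable ℂ φ) (δ κ : ℂ) {n : ℕ}

/-- The coefficient of `∏_{i ∈ I} T_{x_i}^δ` in `D_r`, for `r = #I`. -/
noncomputable def coeffD (I : Finset (Fin n)) : Mero n :=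
  ∏ i ∈ I, ∏ j ∈ Iᶜ, brk hφ i j κ / brk hφ i j 0

/-- The vector with entries `δ` on `I` and `0` elsewhere. -/
def stepVec (I : Finset (Fin n)) : Fin n → ℂ := fun i => if i ∈ I then δ else 0

lemma D_eq_sum (r : ℕ) : D hφ δ κ n r = ∑ I ∈ Finset.powersetCard r Finset.univ,
    shiftOp (n := n) (stepVec δ I) (coeffD hφ κ I) := rfl

lemma D_eq_sum_ite (r : ℕ) : D hφ δ κ n r = ∑ I : Finset (Fin n),
    (if I.card = r then 1 else 0 : ℂ) • shiftOp (stepVec δ I) (coeffD hφ κ I) := by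
  rw [D_eq_sum, Finset.powersetCard_eq_filter, Finset.sum_filter, Finset.powerset_univ]
  refine Finset.sum_congr rfl fun I _ => ?_
  split_ifs <;> simp

/-- Pairs of subsets `(I, J)` are classified by `I ∩ J`, the symmetric difference `S`, and the
part of `S` that belongs to `I`. -/
lemma sum_pairs_eq {α M : Type*} [Fintype α] [DecidableEq α] [AddCommMonoid M]
    (F : Finset α → Finset α → M) :
    ∑ I, ∑ J, F I J = ∑ C : Finset α, ∑ S ∈ Cᶜ.powerset, ∑ P ∈ S.powerset,
      F (C ∪ P) (C ∪ (S \ P)) := by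
  simp only [Finset.sum_sigma']
  refine Finset.sum_bij' (fun p _ => ⟨p.1 ∩ p.2, (p.1 \ p.2) ∪ (p.2 \ p.1), p.1 \ p.2⟩)
    (fun q _ => ⟨q.1 ∪ q.2.2, q.1 ∪ (q.2.1 \ q.2.2)⟩) ?_ ?_ ?_ ?_ ?_
  · rintro ⟨I, J⟩ -
    simp only [Finset.mem_sigma, Finset.mem_univ, Finset.mem_powerset, true_and]
    exact ⟨fun i hi => by simp at hi ⊢; tauto, Finset.subset_union_left⟩
  · simp
  · rintro ⟨I, J⟩ -
    congr 1 <;>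
    · ext i
      simp
      tauto
  · rintro ⟨C, S, P⟩ hq
    simp only [Finset.mem_sigma, Finset.mem_univ, Finset.mem_powerset, true_and] at hq
    obtain ⟨hS, hP⟩ := hq
    have hS' : ∀ i ∈ S, i ∉ C := fun i hi => by simpa using hS hi
    have e1 : (C ∪ P) ∩ (C ∪ (S \ P)) = C := by
      ext i
      have := hS' i
      have := @hP i
      simp
      tauto
    have e2 : (C ∪ P) \ (C ∪ (S \ P)) = P := by
      ext i
      have := hS' i
      have := @hP i
      simp
      tauto
    have e3 : (C ∪ (S \ P)) \ (C ∪ P) = S \ P := by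
      ext i
      have := hS' i
      have := @hP i
      simp
      tauto
    simp only [e1, e2, e3, Finset.union_sdiff_of_subset hP]
  · rintro ⟨I, J⟩ -
    congr 1 <;>
    · ext i
      simp
      tauto

/-- The factor common to all terms of a coefficient of `D_r D_s`. -/
noncomputable def commonFactor (C S : Finset (Fin n)) : Mero n :=
  (∏ i ∈ C, ∏ j ∈ S, brk hφ i j κ / brk hφ i j 0) *
    (∏ i ∈ C, ∏ j ∈ (C ∪ S)ᶜ, brk hφ i j κ / brk hφ i j 0) *
    (∏ i ∈ C, ∏ j ∈ (C ∪ S)ᶜ, brk hφ i j (κ + δ) / brk hφ i j δ) *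
    ∏ i ∈ S, ∏ j ∈ (C ∪ S)ᶜ, brk hφ i j κ / brk hφ i j 0

lemma prod_union_prod_union {ι M : Type*} [DecidableEq ι] [CommMonoid M] {A B A' B' : Finset ι}
    (h : Disjoint A B) (h' : Disjoint A' B') (f : ι → ι → M) :
    ∏ i ∈ A ∪ B, ∏ j ∈ A' ∪ B', f i j = ((∏ i ∈ A, ∏ j ∈ A', f i j) * ∏ i ∈ A, ∏ j ∈ B', f i j) *
      ((∏ i ∈ B, ∏ j ∈ A', f i j) * ∏ i ∈ B, ∏ j ∈ B', f i j) := by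
  rw [Finset.prod_union h]
  simp only [Finset.prod_union h', Finset.prod_mul_distrib]

/-- The coefficient of a term of `D_r D_s`, for the sets `I = C ∪ P` and `J = C ∪ (S \ P)`. -/
lemma coeffD_mul_meroShift (h : IsBracket φ) {C S P : Finset (Fin n)} (hS : S ⊆ Cᶜ) (hP : P ⊆ S) :
    coeffD hφ κ (C ∪ P) * meroShift (stepVec δ (C ∪ P)) (coeffD hφ κ (C ∪ (S \ P))) =
      commonFactor hφ δ κ C S * ∏ p ∈ P, ∏ q ∈ S \ P, pairFun hφ κ δ p q := by
  have hSC : ∀ i ∈ S, i ∉ C := fun i hi => by simpa using hS hi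
  have d1 : Disjoint C P := Finset.disjoint_left.mpr fun i hi hi' => hSC i (hP hi') hi
  have d2 : Disjoint C (S \ P) := Finset.disjoint_left.mpr fun i hi hi' =>
    hSC i (Finset.mem_sdiff.mp hi').1 hi
  have d3 : Disjoint (S \ P) (C ∪ S)ᶜ := Finset.disjoint_left.mpr fun i hi hi' => by
    simp at hi hi'
    tauto
  have d4 : Disjoint P (C ∪ S)ᶜ := Finset.disjoint_left.mpr fun i hi hi' => by
    have := hP hi
    simp at hi'
    tauto
  have c1 : (C ∪ P)ᶜ = (S \ P) ∪ (C ∪ S)ᶜ := by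
    ext i
    have := hSC i
    have := @hP i
    simp
    tauto
  have c2 : (C ∪ (S \ P))ᶜ = P ∪ (C ∪ S)ᶜ := by
    ext i
    have := hSC i
    have := @hP i
    simp
    tauto
  set v := stepVec δ (C ∪ P) with hv
  have vC : ∀ i ∈ C, v i = δ := fun i hi => by simp [hv, stepVec, hi]
  have vP : ∀ i ∈ P, v i = δ := fun i hi => by simp [hv, stepVec, hi]
  have vQ : ∀ i ∈ S \ P, v i = 0 := fun i hi => by
    have := hSC i
    simp at hi
    simp [hv, stepVec]
    tauto
  have vR : ∀ i ∈ (C ∪ S)ᶜ, v i = 0 := fun i hi => by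
    have := @hP i
    simp at hi
    simp [hv, stepVec]
    tauto
  unfold coeffD
  rw [c1, c2, prod_union_prod_union d1 d3]
  simp only [map_prod, map_div₀, meroShift_brk]
  rw [prod_union_prod_union d2 d4]
  have f1 : ∏ i ∈ C, ∏ j ∈ P, brk hφ i j (κ + (v i - v j)) / brk hφ i j (0 + (v i - v j)) =
      ∏ i ∈ C, ∏ j ∈ P, brk hφ i j κ / brk hφ i j 0 :=
    Finset.prod_congr rfl fun i hi => Finset.prod_congr rfl fun j hj => by
      rw [vC i hi, vP j hj, sub_self, add_zero, add_zero]
  have f2 : ∏ i ∈ C, ∏ j ∈ (C ∪ S)ᶜ,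
      brk hφ i j (κ + (v i - v j)) / brk hφ i j (0 + (v i - v j)) =
      ∏ i ∈ C, ∏ j ∈ (C ∪ S)ᶜ, brk hφ i j (κ + δ) / brk hφ i j δ :=
    Finset.prod_congr rfl fun i hi => Finset.prod_congr rfl fun j hj => by
      rw [vC i hi, vR j hj, sub_zero, zero_add]
  have f3 : ∏ i ∈ S \ P, ∏ j ∈ (C ∪ S)ᶜ,
      brk hφ i j (κ + (v i - v j)) / brk hφ i j (0 + (v i - v j)) =
      ∏ i ∈ S \ P, ∏ j ∈ (C ∪ S)ᶜ, brk hφ i j κ / brk hφ i j 0 :=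
    Finset.prod_congr rfl fun i hi => Finset.prod_congr rfl fun j hj => by
      rw [vQ i hi, vR j hj, sub_zero, add_zero, add_zero]
  have f4 : ∏ i ∈ S \ P, ∏ j ∈ P, brk hφ i j (κ + (v i - v j)) / brk hφ i j (0 + (v i - v j)) =
      ∏ i ∈ P, ∏ j ∈ S \ P, brk hφ i j (δ - κ) / brk hφ i j δ := by
    rw [Finset.prod_comm]
    refine Finset.prod_congr rfl fun i hi => Finset.prod_congr rfl fun j hj => ?_
    rw [vQ j hj, vP i hi, show κ + (0 - δ) = -(δ - κ) by ring, zero_add, zero_sub,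
      brk_swap hφ h, brk_swap hφ h, neg_div_neg_eq]
  have f5 : ∏ p ∈ P, ∏ q ∈ S \ P, pairFun hφ κ δ p q =
      (∏ i ∈ P, ∏ j ∈ S \ P, brk hφ i j κ / brk hφ i j 0) *
        ∏ i ∈ P, ∏ j ∈ S \ P, brk hφ i j (δ - κ) / brk hφ i j δ := by
    simp only [pairFun, mul_div_mul_comm, Finset.prod_mul_distrib]
  have f6 : ∏ i ∈ C, ∏ j ∈ S, brk hφ i j κ / brk hφ i j 0 =
      (∏ i ∈ C, ∏ j ∈ S \ P, brk hφ i j κ / brk hφ i j 0) *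
        ∏ i ∈ C, ∏ j ∈ P, brk hφ i j κ / brk hφ i j 0 := by
    rw [← Finset.prod_mul_distrib]
    exact Finset.prod_congr rfl fun i _ => (Finset.prod_sdiff hP).symm
  rw [f1, f2, f3, f4, f5, commonFactor, f6, ← Finset.prod_sdiff hP]
  ring

theorem D_mul_D_comm (h : IsBracket φ) (h1 : φ δ ≠ 0) (h2 : φ (2 * δ) ≠ 0) (r s : ℕ) :
    D hφ δ κ n r * D hφ δ κ n s = D hφ δ κ n s * D hφ δ κ n r := by
  have key : ∀ r s, D hφ δ κ n r * D hφ δ κ n s = ∑ C : Finset (Fin n), ∑ S ∈ Cᶜ.powerset,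
      shiftOp (stepVec δ C + stepVec δ C + stepVec δ S) (commonFactor hφ δ κ C S *
        ∑ P ∈ S.powerset, ((if C.card + P.card = r then 1 else 0 : ℂ) *
          (if C.card + (S.card - P.card) = s then 1 else 0 : ℂ)) •
            ∏ p ∈ P, ∏ q ∈ S \ P, pairFun hφ κ δ p q) := by
    intro r s
    simp only [D_eq_sum_ite, Finset.sum_mul_sum, smul_mul_smul_comm, shiftOp_mul]
    rw [sum_pairs_eq]
    refine Finset.sum_congr rfl fun C _ => Finset.sum_congr rfl fun S hS => ?_
    rw [Finset.mul_sum, map_sum]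
    refine Finset.sum_congr rfl fun P hP => ?_
    have hS := Finset.mem_powerset.mp hS
    have hP := Finset.mem_powerset.mp hP
    have hSC : ∀ i ∈ S, i ∉ C := fun i hi => by simpa using hS hi
    have d1 : Disjoint C P := Finset.disjoint_left.mpr fun i hi hi' => hSC i (hP hi') hi
    have d2 : Disjoint C (S \ P) := Finset.disjoint_left.mpr fun i hi hi' =>
      hSC i (Finset.mem_sdiff.mp hi').1 hi
    have hv : stepVec δ (C ∪ P) + stepVec δ (C ∪ (S \ P)) =
        stepVec δ C + stepVec δ C + stepVec δ S := by
      ext i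
      have g1 := hSC i
      have g2 := @hP i
      by_cases hC : i ∈ C <;> by_cases hS' : i ∈ S <;> by_cases hP' : i ∈ P <;>
        simp_all [stepVec]
    rw [hv, coeffD_mul_meroShift hφ δ κ h hS hP, Finset.card_union_of_disjoint d1,
      Finset.card_union_of_disjoint d2, Finset.card_sdiff_of_subset hP, mul_smul_comm, map_smul]
  rw [key, key]
  refine Finset.sum_congr rfl fun C _ => Finset.sum_congr rfl fun S _ => ?_
  congr 2
  rw [sum_prod_pairFun hφ h h1 h2 S (fun k => (if C.card + k = r then 1 else 0 : ℂ) *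
    (if C.card + (S.card - k) = s then 1 else 0 : ℂ))]
  -- exchange the two parts of `S`
  refine Finset.sum_bij' (fun P _ => S \ P) (fun P _ => S \ P) (by simp) (by simp)
    (fun P hP => Finset.sdiff_sdiff_eq_self (Finset.mem_powerset.mp hP))
    (fun P hP => Finset.sdiff_sdiff_eq_self (Finset.mem_powerset.mp hP)) fun P hP => ?_
  have hP := Finset.mem_powerset.mp hP
  have hc := Finset.card_le_card hP
  rw [Finset.sdiff_sdiff_eq_self hP, Finset.card_sdiff_of_subset hP,
    Nat.sub_sub_self hc, mul_comm, Finset.prod_comm]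

end Commutativity

/-! ### The coefficients of `D_r H_s` -/

section Wronski
variable {φ : ℂ → ℂ} (hφ : Differentiable ℂ φ) (δ κ : ℂ) {n : ℕ}

/-- The quotient `[x_i - x_j + κ + c] / [x_i - x_j + δ + c]`. -/
noncomputable def ratio (i j : Fin n) (c : ℂ) : Mero n := brk hφ i j (κ + c) / brk hφ i j (δ + c)

/-- The effect of the shift by `stepVec δ I` on the denominator `∏_{i < j} [x_i - x_j]`. -/
lemma prod_Ioi_ratio (h : IsBracket φ) (I : Finset (Fin n)) :
    ∏ i, ∏ j ∈ Finset.Ioi i, brk hφ i j 0 / brk hφ i j (stepVec δ I i - stepVec δ I j) =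
      ∏ i ∈ I, ∏ j ∈ Iᶜ, brk hφ i j 0 / brk hφ i j δ := by
  have e1 : ∀ i : Fin n, ∀ j ∈ Finset.Ioi i,
      brk hφ i j 0 / brk hφ i j (stepVec δ I i - stepVec δ I j) =
      (if j ∈ I ∧ i ∉ I then brk hφ j i 0 / brk hφ j i δ else 1) *
        (if i ∈ I ∧ j ∉ I then brk hφ i j 0 / brk hφ i j δ else 1) := by
    intro i j hj
    have hij : i ≠ j := (Finset.mem_Ioi.mp hj).ne
    have h0 := brk_ne_zero hφ h hij 0
    have hs : brk hφ j i 0 = -brk hφ i j 0 := by simpa using brk_swap hφ h i j 0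
    have hs' : brk hφ j i δ = -brk hφ i j (-δ) := by simpa using brk_swap hφ h i j (-δ)
    by_cases hi : i ∈ I <;> by_cases hj : j ∈ I <;>
      simp [stepVec, hi, hj, h0, hs, hs', neg_div_neg_eq]
  rw [Finset.prod_congr rfl fun i _ => Finset.prod_congr rfl (e1 i),
    Finset.prod_prod_Ioi_mul_eq_prod_prod_off_diag
      (fun i j => if i ∈ I ∧ j ∉ I then brk hφ i j 0 / brk hφ i j δ else 1),
    Finset.prod_comm' (t' := Finset.univ) (s' := fun j => {j}ᶜ) (by simp [eq_comm])]
  rw [← Finset.prod_subset (Finset.subset_univ I)]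
  · refine Finset.prod_congr rfl fun i hi => ?_
    rw [← Finset.prod_subset (s₁ := Iᶜ) (s₂ := {i}ᶜ)]
    · refine Finset.prod_congr rfl fun j hj => ?_
      rw [if_pos ⟨hi, by simpa using hj⟩]
    · intro j hj
      simp only [Finset.mem_compl, Finset.mem_singleton] at hj ⊢
      rintro rfl
      exact hj hi
    · intro j _ hj
      rw [if_neg fun hh => hj (by simpa using hh.2)]
  · intro i _ hi
    exact Finset.prod_eq_one fun j _ => if_neg fun hh => hi hh.1

/-- For a pair `(i, j)`, the dependence on `I` of the contribution to the coefficient of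
`T_x^{νδ}` in `D_r H_s`. -/
lemma ratio_pair (I : Finset (Fin n)) (i j : Fin n) (m : ℕ) :
    (if i ∈ I ∧ j ∉ I then ratio hφ δ κ i j 0 else 1) *
      ∏ k ∈ Finset.range (m + 1 - if i ∈ I then 1 else 0),
        ratio hφ δ κ i j (k * δ + (stepVec δ I i - stepVec δ I j)) =
      (∏ k ∈ Finset.range m, ratio hφ δ κ i j (k * δ)) *
        if j ∈ I then (if i ∈ I then 1 else ratio hφ δ κ i j (-δ))
        else ratio hφ δ κ i j (m * δ) := by
  have e1 : ∀ k : ℕ, (k : ℂ) * δ + δ = ((k + 1 : ℕ) : ℂ) * δ := fun k => by push_cast; ring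
  have e2 : ∀ k : ℕ, ((k + 1 : ℕ) : ℂ) * δ + -δ = k * δ := fun k => by push_cast; ring
  by_cases hi : i ∈ I <;> by_cases hj : j ∈ I
  · simp [stepVec, hi, hj]
  · simp only [stepVec, hi, hj, if_true, if_false, not_false_eq_true, and_self,
      Nat.add_sub_cancel, sub_zero, e1]
    rw [← Finset.prod_range_succ, Finset.prod_range_succ', mul_comm]
    simp
  · simp only [stepVec, hi, hj, if_true, if_false, false_and, one_mul, Nat.sub_zero, zero_sub]
    rw [Finset.prod_range_succ']
    simp only [e2]
    simp
  · simp [stepVec, hi, hj, Finset.prod_range_succ]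

lemma meroShift_coeffH (h : IsBracket φ) (v : Fin n → ℂ) (μ ν : Fin n → ℕ) {I : Finset (Fin n)}
    (hv : v = stepVec δ I) (hμ : ∀ i, (μ i : ℂ) * δ + v i = ν i * δ) :
    meroShift v (coeffH hφ δ κ μ) =
      ((∏ i, ∏ j ∈ Finset.Ioi i, brk hφ i j (((ν i : ℂ) - (ν j : ℂ)) * δ) / brk hφ i j 0) *
        ∏ i ∈ I, ∏ j ∈ Iᶜ, brk hφ i j 0 / brk hφ i j δ) *
      ∏ i, ∏ j, ∏ k ∈ Finset.range (μ i), ratio hφ δ κ i j (k * δ + (v i - v j)) := by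
  rw [← prod_Ioi_ratio hφ δ h]
  simp only [coeffH, map_mul, map_prod, map_div₀, meroShift_brk]
  congr 1
  · simp only [← Finset.prod_mul_distrib]
    refine Finset.prod_congr rfl fun i _ => Finset.prod_congr rfl fun j hj => ?_
    have h0 := brk_ne_zero hφ h (Finset.mem_Ioi.mp hj).ne 0
    rw [← hv, zero_add, show ((μ i : ℂ) - μ j) * δ + (v i - v j) = (ν i - ν j) * δ by
      linear_combination hμ i - hμ j]
    field_simp
  · simp only [ratio, add_assoc]

/-- The part of the coefficient of `T_x^{νδ}` in `D_r H_s` that does not depend on `I`; here `S`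
is the support of `ν`. -/
noncomputable def wronskiFactor (ν : Fin n → ℕ) (S : Finset (Fin n)) : Mero n :=
  (∏ i, ∏ j ∈ Finset.Ioi i, brk hφ i j (((ν i : ℂ) - (ν j : ℂ)) * δ) / brk hφ i j 0) *
    (∏ i ∈ S, ∏ j, ∏ k ∈ Finset.range (ν i - 1), ratio hφ δ κ i j (k * δ)) *
    (∏ i ∈ S, ∏ j ∈ Sᶜ, ratio hφ δ κ i j ((ν i - 1 : ℕ) * δ)) /
    ∏ j ∈ S, ∏ i ∈ S, brk hφ j i (-(ν i * δ))

/-- The term of the coefficient of `T_x^{νδ}` in `D_r H_s` that belongs to the subset `I` is, up to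
a factor independent of `I`, the corresponding term of `sum_wronski` with `t = δ - κ`. Only the
support `S` of `ν` is used as index set there: an index with `ν i = 0` would contribute the common
factor `[δ - κ]`, which may vanish. -/
lemma coeffD_mul_meroShift_coeffH (h : IsBracket φ) (hδ : ∀ k : ℕ, 1 ≤ k → φ (k * δ) ≠ 0)
    (ν : Fin n → ℕ) {S I : Finset (Fin n)} (hS : ∀ i, i ∈ S ↔ ν i ≠ 0) (hI : I ⊆ S) :
    coeffD hφ κ I * meroShift (stepVec δ I) (coeffH hφ δ κ fun i => ν i - if i ∈ I then 1 else 0) =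
      wronskiFactor hφ δ κ ν S *
        ((∏ i ∈ I, ∏ j ∈ S \ I, brk hφ i j (δ - κ) / brk hφ i j 0) *
        (∏ i ∈ I, ∏ k ∈ S, brk hφ i k (-(ν k * δ))) *
        ∏ i ∈ S \ I, ∏ k ∈ S, brk hφ i k (δ - κ - ν k * δ)) := by
  have hνI : ∀ i ∈ I, 1 ≤ ν i := fun i hi => Nat.one_le_iff_ne_zero.mpr ((hS i).mp (hI hi))
  rw [meroShift_coeffH hφ δ κ h (stepVec δ I) _ ν rfl fun i => by
    by_cases hi : i ∈ I
    · simp only [hi, if_true, stepVec]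
      rw [Nat.cast_sub (hνI i hi)]
      push_cast
      ring
    · simp [hi, stepVec]]
  have e1 : coeffD hφ κ I * ∏ i ∈ I, ∏ j ∈ Iᶜ, brk hφ i j 0 / brk hφ i j δ =
      ∏ i, ∏ j, if i ∈ I ∧ j ∉ I then ratio hφ δ κ i j 0 else 1 := by
    rw [coeffD, ← Finset.prod_mul_distrib, ← Finset.prod_subset (Finset.subset_univ I)]
    · refine Finset.prod_congr rfl fun i hi => ?_
      rw [← Finset.prod_mul_distrib, ← Finset.prod_subset (Finset.subset_univ Iᶜ)]
      · refine Finset.prod_congr rfl fun j hj => ?_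
        have hj : j ∉ I := by simpa using hj
        have hij : i ≠ j := by rintro rfl; exact hj hi
        rw [if_pos ⟨hi, hj⟩, ratio, add_zero, add_zero]
        have h0 := brk_ne_zero hφ h hij 0
        field_simp
      · intro j _ hj
        rw [if_neg fun hh => hj (by simpa using hh.2)]
    · intro i _ hi
      exact Finset.prod_eq_one fun j _ => if_neg fun hh => hi hh.1
  have e2 : (∏ i, ∏ j, if i ∈ I ∧ j ∉ I then ratio hφ δ κ i j 0 else 1) *
      ∏ i, ∏ j, ∏ k ∈ Finset.range (ν i - if i ∈ I then 1 else 0),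
        ratio hφ δ κ i j (k * δ + (stepVec δ I i - stepVec δ I j)) =
      ∏ i ∈ S, ∏ j, ((∏ k ∈ Finset.range (ν i - 1), ratio hφ δ κ i j (k * δ)) *
        if j ∈ I then (if i ∈ I then 1 else ratio hφ δ κ i j (-δ))
        else ratio hφ δ κ i j ((ν i - 1 : ℕ) * δ)) := by
    rw [← Finset.prod_mul_distrib, ← Finset.prod_subset (Finset.subset_univ S)]
    · refine Finset.prod_congr rfl fun i hi => ?_
      rw [← Finset.prod_mul_distrib]
      refine Finset.prod_congr rfl fun j _ => ?_
      obtain ⟨m, hm⟩ := Nat.exists_eq_succ_of_ne_zero ((hS i).mp hi)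
      rw [hm, Nat.succ_eq_add_one, Nat.add_sub_cancel]
      exact ratio_pair hφ δ κ I i j m
    · intro i _ hi
      have h0 : ν i = 0 := by simpa using mt (hS i).mpr hi
      have hiI : i ∉ I := fun hh => hi (hI hh)
      simp [h0, hiI]
  have e3 : ∏ i ∈ S, ∏ j, (if j ∈ I then (if i ∈ I then 1 else ratio hφ δ κ i j (-δ))
        else ratio hφ δ κ i j ((ν i - 1 : ℕ) * δ)) =
      (∏ i ∈ I, ∏ j ∈ S \ I, brk hφ i j (δ - κ) / brk hφ i j 0) *
      (∏ i ∈ S \ I, ∏ k ∈ S, brk hφ i k (δ - κ - ν k * δ) / brk hφ i k (-(ν k * δ))) *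
      ∏ i ∈ S, ∏ j ∈ Sᶜ, ratio hφ δ κ i j ((ν i - 1 : ℕ) * δ) := by
    have g1 : ∀ i ∈ S, ∏ j, (if j ∈ I then (if i ∈ I then 1 else ratio hφ δ κ i j (-δ))
        else ratio hφ δ κ i j ((ν i - 1 : ℕ) * δ)) =
        ((∏ j ∈ I, if i ∈ I then 1 else ratio hφ δ κ i j (-δ)) *
          ∏ j ∈ S \ I, ratio hφ δ κ i j ((ν i - 1 : ℕ) * δ)) *
          ∏ j ∈ Sᶜ, ratio hφ δ κ i j ((ν i - 1 : ℕ) * δ) := by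
      intro i _
      rw [← Finset.prod_mul_prod_compl S, ← Finset.prod_sdiff hI, mul_comm (∏ j ∈ S \ I, _)]
      congr 1
      · congr 1
        · exact Finset.prod_congr rfl fun j hj => if_pos hj
        · exact Finset.prod_congr rfl fun j hj => if_neg (Finset.mem_sdiff.mp hj).2
      · exact Finset.prod_congr rfl fun j hj => if_neg fun hh => (Finset.mem_compl.mp hj) (hI hh)
    rw [Finset.prod_congr rfl g1, Finset.prod_mul_distrib, Finset.prod_mul_distrib]
    congr 1
    congr 1
    · rw [← Finset.prod_sdiff hI, Finset.prod_eq_one (s := I) fun i hi => by simp [hi], mul_one,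
        Finset.prod_comm]
      refine Finset.prod_congr rfl fun j hj => Finset.prod_congr rfl fun i hi => ?_
      rw [if_neg (Finset.mem_sdiff.mp hi).2, ratio, ← sub_eq_add_neg, ← neg_sub δ κ,
        add_neg_cancel, brk_swap hφ h j i, ← neg_zero, brk_swap hφ h j i, neg_div_neg_eq, neg_zero]
    · rw [Finset.prod_comm]
      refine Finset.prod_congr rfl fun j _ => Finset.prod_congr rfl fun i hi => ?_
      have hν : 1 ≤ ν i := Nat.one_le_iff_ne_zero.mpr ((hS i).mp hi)
      rw [ratio, Nat.cast_sub hν, Nat.cast_one,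
        show κ + ((ν i : ℂ) - 1) * δ = -(δ - κ - ν i * δ) by ring,
        show δ + ((ν i : ℂ) - 1) * δ = -(-(ν i * δ)) by ring, brk_swap hφ h, brk_swap hφ h,
        neg_div_neg_eq]
  have hne : ∀ j ∈ S, ∀ i ∈ S, brk hφ j i (-(ν i * δ)) ≠ 0 := by
    intro j _ i hi
    by_cases hij : j = i
    · subst hij
      rw [brk_self, h.map_neg]
      exact (map_ne_zero _).mpr
        (neg_ne_zero.mpr (hδ _ (Nat.one_le_iff_ne_zero.mpr ((hS _).mp hi))))
    · exact brk_ne_zero hφ h hij _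
  have hne1 : ∏ i ∈ S \ I, ∏ k ∈ S, brk hφ i k (-(ν k * δ)) ≠ 0 :=
    Finset.prod_ne_zero_iff.mpr fun i hi => Finset.prod_ne_zero_iff.mpr
      (hne i (Finset.mem_sdiff.mp hi).1)
  have hne2 : ∏ i ∈ I, ∏ k ∈ S, brk hφ i k (-(ν k * δ)) ≠ 0 :=
    Finset.prod_ne_zero_iff.mpr fun i hi => Finset.prod_ne_zero_iff.mpr (hne i (hI hi))
  rw [← mul_assoc, mul_left_comm, e1, mul_assoc, e2]
  simp only [Finset.prod_mul_distrib]
  rw [e3, wronskiFactor, ← Finset.prod_sdiff hI (f := fun j => ∏ i ∈ S, brk hφ j i (-(ν i * δ)))]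
  have e4 : ∏ i ∈ S \ I, ∏ k ∈ S, brk hφ i k (δ - κ - ν k * δ) / brk hφ i k (-(ν k * δ)) =
      (∏ i ∈ S \ I, ∏ k ∈ S, brk hφ i k (δ - κ - ν k * δ)) /
        ∏ i ∈ S \ I, ∏ k ∈ S, brk hφ i k (-(ν k * δ)) := by
    simp only [Finset.prod_div_distrib]
  rw [e4]
  generalize (∏ i ∈ S \ I, ∏ k ∈ S, brk hφ i k (-(ν k * δ))) = b at hne1 ⊢
  generalize (∏ i ∈ I, ∏ k ∈ S, brk hφ i k (-(ν k * δ))) = b' at hne2 ⊢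
  generalize (∏ i ∈ S \ I, ∏ k ∈ S, brk hφ i k (δ - κ - ν k * δ)) = a
  generalize (∏ i ∈ I, ∏ j ∈ S \ I, brk hφ i j (δ - κ) / brk hφ i j 0) = c
  generalize (∏ i ∈ S, ∏ j ∈ Sᶜ, ratio hφ δ κ i j ((ν i - 1 : ℕ) * δ)) = d
  generalize (∏ i ∈ S, ∏ j, ∏ k ∈ Finset.range (ν i - 1), ratio hφ δ κ i j (k * δ)) = e
  generalize (∏ i, ∏ j ∈ Finset.Ioi i,
    brk hφ i j (((ν i : ℂ) - (ν j : ℂ)) * δ) / brk hφ i j 0) = f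
  field_simp

end Wronski

/-! ### The Wronski relation and its consequences -/

section Recursion
variable {φ : ℂ → ℂ} (hφ : Differentiable ℂ φ) (δ κ : ℂ) {n : ℕ}

lemma H_eq_sum (l : ℕ) : H hφ δ κ n l = ∑ μ ∈ Finset.piAntidiag (Finset.univ : Finset (Fin n)) l,
    shiftOp (n := n) (fun i => (μ i : ℂ) * δ) (coeffH hφ δ κ μ) := rfl

/-- Pairs of a subset `I` and a multi-index `μ` of total size `k` correspond to a multi-index
`ν = μ + 1_I` together with a subset `I` of its support. -/
lemma sum_subset_piAntidiag {α M : Type*} [Fintype α] [DecidableEq α] [AddCommMonoid M] (k : ℕ)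
    (F : Finset α → (α → ℕ) → M) :
    ∑ r ∈ Finset.range (k + 1), ∑ I ∈ Finset.powersetCard r Finset.univ,
        ∑ μ ∈ Finset.piAntidiag Finset.univ (k - r), F I μ =
      ∑ ν ∈ Finset.piAntidiag Finset.univ k,
        ∑ I ∈ (Finset.univ.filter fun i => ν i ≠ 0).powerset,
          F I fun i => ν i - if i ∈ I then 1 else 0 := by
  have hcard : ∀ I : Finset α, ∑ i, (if i ∈ I then 1 else 0) = I.card := fun I => by simp
  simp only [Finset.sum_sigma']
  refine Finset.sum_bij'
    (fun p _ => ⟨fun i => p.2.2 i + if i ∈ p.2.1 then 1 else 0, p.2.1⟩)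
    (fun q _ => ⟨q.2.card, q.2, fun i => q.1 i - if i ∈ q.2 then 1 else 0⟩) ?_ ?_ ?_ ?_ ?_
  · rintro ⟨r, I, μ⟩ hp
    simp only [Finset.mem_sigma, Finset.mem_range, Finset.mem_powersetCard_univ,
      Finset.mem_piAntidiag, Finset.mem_powerset] at hp ⊢
    obtain ⟨hr, hI, hμ, -⟩ := hp
    refine ⟨⟨?_, by simp⟩, fun i hi => by simp [hi]⟩
    rw [Finset.sum_add_distrib, hcard, hμ, hI]
    omega
  · rintro ⟨ν, I⟩ hq
    simp only [Finset.mem_sigma, Finset.mem_range, Finset.mem_powersetCard_univ,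
      Finset.mem_piAntidiag, Finset.mem_powerset] at hq ⊢
    obtain ⟨⟨hν, -⟩, hI⟩ := hq
    have hle : ∀ i, (if i ∈ I then 1 else 0) ≤ ν i := fun i => by
      split_ifs with hi
      · have := hI hi
        simp at this
        omega
      · omega
    have hIk : I.card ≤ k := by
      rw [← hcard I, ← hν]
      exact Finset.sum_le_sum fun i _ => hle i
    refine ⟨by omega, trivial, ?_, by simp⟩
    rw [Finset.sum_tsub_distrib _ fun i _ => hle i, hcard, hν]
  · rintro ⟨r, I, μ⟩ hp
    simp only [Finset.mem_sigma, Finset.mem_powersetCard_univ] at hp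
    obtain ⟨-, rfl, -⟩ := hp
    simp
  · rintro ⟨ν, I⟩ hq
    simp only [Finset.mem_sigma, Finset.mem_powerset] at hq
    obtain ⟨-, hI⟩ := hq
    have : (fun i => ν i - (if i ∈ I then 1 else 0) + if i ∈ I then 1 else 0) = ν := by
      ext i
      split_ifs with hi
      · have := hI hi
        simp at this
        omega
      · omega
    simp only [this]
  · rintro ⟨r, I, μ⟩ -
    simp

/-- The Wronski relation between the operators `D_r` and `H_s`. -/
theorem wronski_relation (h : IsBracket φ) (hδ : ∀ k : ℕ, 1 ≤ k → φ (k * δ) ≠ 0) (k : ℕ) :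
    ∑ r ∈ Finset.range (k + 1), ((-1) ^ r * φ (r * κ + (k - r : ℕ) * δ)) •
      (D hφ δ κ n r * H hφ δ κ n (k - r)) = 0 := by
  have e1 : ∀ r ∈ Finset.range (k + 1), ((-1) ^ r * φ (r * κ + (k - r : ℕ) * δ)) •
      (D hφ δ κ n r * H hφ δ κ n (k - r)) =
      ∑ I ∈ Finset.powersetCard r Finset.univ, ∑ μ ∈ Finset.piAntidiag Finset.univ (k - r),
        shiftOp (n := n) (stepVec δ I + fun i => (μ i : ℂ) * δ)
          (((-1) ^ I.card * φ (I.card * κ + (k - I.card : ℕ) * δ)) •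
            (coeffD hφ κ I * meroShift (n := n) (stepVec δ I) (coeffH hφ δ κ μ))) := by
    intro r _
    rw [D_eq_sum, H_eq_sum, Finset.sum_mul_sum, Finset.smul_sum]
    refine Finset.sum_congr rfl fun I hI => ?_
    rw [(Finset.mem_powersetCard.mp hI).2, Finset.smul_sum]
    refine Finset.sum_congr rfl fun μ _ => ?_
    rw [shiftOp_mul, map_smul]
  rw [Finset.sum_congr rfl e1, sum_subset_piAntidiag k fun I μ =>
    shiftOp (n := n) (stepVec δ I + fun i => (μ i : ℂ) * δ)
          (((-1) ^ I.card * φ (I.card * κ + (k - I.card : ℕ) * δ)) •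
            (coeffD hφ κ I * meroShift (n := n) (stepVec δ I) (coeffH hφ δ κ μ)))]
  refine Finset.sum_eq_zero fun ν hν => ?_
  set S := Finset.univ.filter fun i => ν i ≠ 0 with hS
  have hmem : ∀ i, i ∈ S ↔ ν i ≠ 0 := fun i => by simp [hS]
  have hνk : ∑ i ∈ S, ν i = k := by
    rw [hS, Finset.sum_filter_ne_zero]
    exact (Finset.mem_piAntidiag.mp hν).1
  have e2 : ∀ I ∈ S.powerset,
      shiftOp (n := n) (stepVec δ I + fun i => ((ν i - if i ∈ I then 1 else 0 : ℕ) : ℂ) * δ)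
          (((-1) ^ I.card * φ (I.card * κ + (k - I.card : ℕ) * δ)) •
            (coeffD hφ κ I * meroShift (n := n) (stepVec δ I)
              (coeffH hφ δ κ fun i => ν i - if i ∈ I then 1 else 0))) =
      shiftOp (n := n) (fun i => ν i * δ) (-wronskiFactor hφ δ κ ν S *
        (((-1) ^ I.card * φ (I.card * (δ - κ) - ∑ k ∈ S, ν k * δ)) •
          ((∏ i ∈ I, ∏ j ∈ S \ I, brk hφ i j (δ - κ) / brk hφ i j 0) *
        (∏ i ∈ I, ∏ k ∈ S, brk hφ i k (-(ν k * δ))) *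
        ∏ i ∈ S \ I, ∏ k ∈ S, brk hφ i k (δ - κ - ν k * δ)))) := by
    intro I hI
    have hI := Finset.mem_powerset.mp hI
    have hle : ∀ i ∈ I, 1 ≤ ν i := fun i hi => Nat.one_le_iff_ne_zero.mpr ((hmem i).mp (hI hi))
    have hIk : I.card ≤ k := by
      rw [← hνk, Finset.card_eq_sum_ones]
      exact (Finset.sum_le_sum hle).trans (Finset.sum_le_sum_of_subset hI)
    rw [coeffD_mul_meroShift_coeffH hφ δ κ h hδ ν hmem hI]
    congr 1
    · congr 1
      ext i
      by_cases hi : i ∈ I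
      · simp only [Pi.add_apply, stepVec, hi, if_true]
        rw [Nat.cast_sub (hle i hi)]
        push_cast
        ring
      · simp [stepVec, hi]
    · rw [← Finset.sum_mul, ← Nat.cast_sum, hνk, Nat.cast_sub hIk,
        show (I.card : ℂ) * (δ - κ) - k * δ = -(I.card * κ + (k - I.card) * δ) by ring, h.map_neg,
        mul_neg, neg_smul, mul_neg, neg_mul, neg_neg, mul_smul_comm]
  rw [Finset.sum_congr rfl e2, ← map_sum, ← Finset.mul_sum,
    sum_wronski hφ h S (fun k => ν k * δ) (δ - κ), mul_zero, map_zero]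

lemma D_zero : D hφ δ κ n 0 = 1 := by
  rw [D_eq_sum, Finset.powersetCard_zero, Finset.sum_singleton]
  refine LinearMap.ext fun f => ?_
  change coeffD hφ κ ∅ * meroShift (n := n) (stepVec δ ∅) f = f
  have e : stepVec (n := n) δ ∅ = 0 := by
    ext i
    simp [stepVec]
  obtain ⟨a, b, _, rfl⟩ := IsFractionRing.div_surjective (A := Entire n) f
  have hs : ∀ e : Entire n, entireShift 0 e = e := fun e =>
    Subtype.ext (funext fun x => congrArg e.1 (add_zero x))
  simp only [coeffD, Finset.prod_empty, one_mul, e, map_div₀, meroShift_algebraMap, hs]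

lemma D_mem_ruijsenaarsAlgebra (r : ℕ) : D hφ δ κ n r ∈ ruijsenaarsAlgebra hφ δ κ n := by
  rcases Nat.eq_zero_or_pos r with rfl | hr
  · rw [D_zero]
    exact one_mem _
  rcases le_or_gt r n with hrn | hrn
  · exact Algebra.subset_adjoin ⟨r, ⟨hr, hrn⟩, rfl⟩
  · rw [D_eq_sum, Finset.powersetCard_eq_empty.mpr (by simpa using hrn), Finset.sum_empty]
    exact zero_mem _

/-- The coefficient `[kδ]` of `H_k` in the Wronski relation does not vanish, so that the relation
determines `H_k` recursively. -/
theorem H_mem_ruijsenaarsAlgebra (h : IsBracket φ) (hδ : ∀ k : ℕ, 1 ≤ k → φ (k * δ) ≠ 0) (l : ℕ) :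
    H hφ δ κ n l ∈ ruijsenaarsAlgebra hφ δ κ n := by
  induction l using Nat.strong_induction_on with
  | _ l ih =>
    rcases Nat.eq_zero_or_pos l with rfl | hl
    · have : H hφ δ κ n 0 = D hφ δ κ n 0 := by
        rw [H_eq_sum, D_eq_sum, Finset.piAntidiag_zero, Finset.powersetCard_zero,
          Finset.sum_singleton, Finset.sum_singleton]
        have e1 : coeffH hφ δ κ (0 : Fin n → ℕ) = coeffD hφ κ ∅ := by
          have e0 : ∀ i : Fin n, ∀ j ∈ Finset.Ioi i,
              brk hφ i j (((0 : Fin n → ℕ) i - (0 : Fin n → ℕ) j : ℂ) * δ) / brk hφ i j 0 = 1 :=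
            fun i j hj => by
              simpa using div_self (brk_ne_zero hφ h (Finset.mem_Ioi.mp hj).ne 0)
          rw [coeffH, Finset.prod_congr rfl fun i _ => Finset.prod_congr rfl (e0 i)]
          simp [coeffD]
        have e2 : (fun i => ((0 : Fin n → ℕ) i : ℂ) * δ) = stepVec δ ∅ := by
          ext i
          simp [stepVec]
        rw [e1, e2]
      rw [this]
      exact D_mem_ruijsenaarsAlgebra hφ δ κ 0
    · have hw := wronski_relation hφ δ κ (n := n) h hδ l
      rw [Finset.sum_range_succ', D_zero] at hw
      simp only [pow_zero, one_mul, Nat.cast_zero, zero_mul, zero_add, Nat.sub_zero] at hw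
      have hmem : φ (l * δ) • H hφ δ κ n l ∈ ruijsenaarsAlgebra hφ δ κ n := by
        rw [eq_neg_of_add_eq_zero_right hw]
        refine neg_mem (sum_mem fun r _ => Subalgebra.smul_mem _ (mul_mem ?_ (ih _ (by omega))) _)
        exact D_mem_ruijsenaarsAlgebra hφ δ κ _
      have := Subalgebra.smul_mem _ hmem (φ (l * δ))⁻¹
      rwa [smul_smul, inv_mul_cancel₀ (hδ l hl), one_smul] at this

end Recursion

end Ruijsenaars

theorem theorem1p1
    (φ : ℂ → ℂ) (hφ : Differentiable ℂ φ) (hφ0 : φ ≠ 0)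
    (hHirota : ∀ z α β γ : ℂ,
      φ (z + α) * φ (z - α) * (φ (β + γ) * φ (β - γ)) +
        φ (z + β) * φ (z - β) * (φ (γ + α) * φ (γ - α)) +
        φ (z + γ) * φ (z - γ) * (φ (α + β) * φ (α - β)) = 0)
    (n : ℕ) (δ κ : ℂ) (hδ : ∀ k : ℕ, 1 ≤ k → φ ((k : ℂ) * δ) ≠ 0) :
    (∀ r s : ℕ, Ruijsenaars.D hφ δ κ n r * Ruijsenaars.D hφ δ κ n s =
      Ruijsenaars.D hφ δ κ n s * Ruijsenaars.D hφ δ κ n r) ∧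
    (∀ l : ℕ, Ruijsenaars.H hφ δ κ n l ∈ Ruijsenaars.ruijsenaarsAlgebra hφ δ κ n) ∧
    (∀ r s : ℕ, Ruijsenaars.D hφ δ κ n r * Ruijsenaars.H hφ δ κ n s =
      Ruijsenaars.H hφ δ κ n s * Ruijsenaars.D hφ δ κ n r) ∧
    (∀ r s : ℕ, Ruijsenaars.H hφ δ κ n r * Ruijsenaars.H hφ δ κ n s =
      Ruijsenaars.H hφ δ κ n s * Ruijsenaars.H hφ δ κ n r) := by
  have h : Ruijsenaars.IsBracket φ := ⟨hφ, hφ0, hHirota⟩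
  have hDD := Ruijsenaars.D_mul_D_comm hφ δ κ (n := n) h (by simpa using hδ 1 le_rfl)
    (by simpa using hδ 2 one_le_two)
  have hH := Ruijsenaars.H_mem_ruijsenaarsAlgebra hφ δ κ (n := n) h hδ
  have hDH : ∀ r s : ℕ, Commute (Ruijsenaars.D hφ δ κ n r) (Ruijsenaars.H hφ δ κ n s) :=
    fun r s => Algebra.commute_of_mem_adjoin_of_forall_mem_commute (hH s) (by
      rintro _ ⟨q, _, rfl⟩
      exact hDD r q)
  refine ⟨hDD, hH, hDH, fun r s => ?_⟩
  exact Algebra.commute_of_mem_adjoin_of_forall_mem_commute (hH s) (by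
    rintro _ ⟨q, _, rfl⟩
    exact (hDH q r).symm)
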